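/- **Definitions.** A metrizable space $X$ is an ANR (respectively an AR) if every continuous map $f:B\to X$ from a closed subset $B$ of a metrizable space $Y$ extends continuously to a neighborhood of $B$ in $Y$ (respectively to all of $Y$). A subset $A$ of a space $X$ is homotopy dense in $X$ if there is a homotopy $\varphi_t:X\to X$ $(0\le t\le 1)$ with $\varphi_0=\mathrm{id}_X$ and $\varphi_t(X)\subset A$ for $0<t\le 1$. We write $X\simeq *$ if $X$ is contractible. Let $M$ be a locally compact, $\sigma$-compact Hausdorff space and let $G$ be a topological group acting continuously and effectively on $M$. For $K,N\subset M$ let $G_K=\{g\in G: g|_K=\mathrm{id}_K\}$, $G(N)=G_{M\setminus N}$ and $G_K(N)=G_K\cap G(N)$. For a subgroup $H$ of $G$, $H_0$ denotes the connected component of the unit element $e$ in $H$. Let $$G^{c*}_0=\{h\in G:\ \operatorname{supp}(h)\text{ is compact and } h\in G(K)_0 \text{ for some compact } K\subset M\},$$ where $\operatorname{supp}(h)$ is the closure of $\{x\in M: hx\neq x\}$. For $K\subset L\subset N\subset M$ the set $\mathcal E^G_K(L,N)=\{g|_L:L\to M\mid g\in G_K(N)\}$ is given the quotient topology induced by the restriction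 map $G_K(N)\to\mathcal E^G_K(L,N)$, $g\mapsto g|_L$, and $\mathcal E^G_K(L,N)_0$ denotes the connected component of the inclusion $L\subset M$. Let $\{M_i\}_{i\ge 1}$ be an exhausting sequence of $M$, that is, a sequence of compact subsets with $M=\bigcup_i M_i$ and $M_{i-1}\subset U_i:=\operatorname{Int}_M M_i$ for $i\ge1$, where $M_0=\emptyset$. **Assumption (A).** * (A-0) $G$ is metrizable, and $(G,M)$ has a weak topology: for each neighborhood $U$ of $e$ in $G$ there is a compact $K\subset M$ with $G_K\subset U$. * (A-1) For all $j>i>k\ge0$ the restriction map $G_{M_k}(U_j)_0\to\mathcal E^G_{M_k}(M_i,U_j)_0$ is a principal bundle with structure group $\mathcal G^i_{k,j}:=G_{M_k}(U_j)_0\cap G_{M_i}$ (acting by right translations). * (A-2)(i) $G(U_i)_0$ is an ANR for each $i\ge1$. * (A-2)(ii) For all $i>k\ge0$, the spaces $\mathcal U^i_{k,j}:=\mathcal E^G_{M_k}(M_i,U_j)_0$ $(j>i)$ are open subspaces of $\mathcal E^G_{M_k}(M_i,M)_0$, they cover $\mathcal E^G_{M_k}(M_i,M)_0$, and $\operatorname{cl}\,\mathcal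 U^i_{k,j}\subset\mathcal U^i_{k,j+1}$ for each $j>i$. **Theorem.** Suppose $(G,M,\{M_i\}_{i\ge1})$ satisfies Assumption (A). 1. If $G_{M_k}(U_i)_0\simeq *$ for all $i>k\ge0$ and $\mathcal G^i_{k,j}$ is connected for all $j>i>k\ge0$, then $G_0$ is an AR and $G^{c*}_0$ is homotopy dense in $G_0$. 2. (i) If $G_{M_i}\simeq *$ for each $i\ge1$, then $G_0$ is an ANR. (ii) If $G_{M_1}$ is connected and $\mathcal G^i_{1,j}=G_{M_1}(U_j)_0\cap G_{M_i}\simeq *$ for all $j>i\ge2$, then $G^{c*}_0$ is homotopy dense in $G_0$. -/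

import Mathlib

open Set Topology

universe u v

set_option linter.unusedSectionVars false

/-! ### ARs, ANRs and homotopy density -/

/-- `X` is metrizable, and every map from a closed subset `B` of a metrizable space `Y` into `X`
extends to a neighbourhood of `B` in `Y`. Every metrizable space embeds as a closed subset of a
convex subset of a normed space in its own universe, so it makes no difference that the test
spaces `Y` are taken in the universe of `X`. -/
def IsANR (X : Type u) [TopologicalSpace X] : Prop :=
  TopologicalSpace.MetrizableSpace X ∧
    ∀ (Y : Type u) [TopologicalSpace Y] [TopologicalSpace.MetrizableSpace Y]
      (B : Set Y), IsClosed B → ∀ f : C(B, X),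
        ∃ (U : Set Y) (hBU : B ⊆ U), U ∈ 𝓝ˢ B ∧
          ∃ F : C(U, X), ∀ b : B, F (inclusion hBU b) = f b

/-- `X` is metrizable, and every map from a closed subset `B` of a metrizable space `Y` into `X`
extends to `Y`. -/
def IsAR (X : Type u) [TopologicalSpace X] : Prop :=
  TopologicalSpace.MetrizableSpace X ∧
    ∀ (Y : Type u) [TopologicalSpace Y] [TopologicalSpace.MetrizableSpace Y]
      (B : Set Y), IsClosed B → ∀ f : C(B, X), ∃ F : C(Y, X), ∀ b : B, F b = f b

/-- There is a homotopy `φ_t : X → X` with `φ_0 = id` and `φ_t(X) ⊆ A` for `0 < t ≤ 1`. -/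
def IsHomotopyDense {X : Type u} [TopologicalSpace X] (A : Set X) : Prop :=
  ∃ φ : C(X × unitInterval, X),
    (∀ x, φ (x, 0) = x) ∧ ∀ x (t : unitInterval), 0 < t → φ (x, t) ∈ A

/-! ### Principal bundles -/

/-- `p : P → B`, defined on a topological group `P`, is a principal bundle with structure group
the subgroup `S` of `P` acting on `P` by right translations: each point of `B` lies in the
(open) base set of a local trivialization `p ⁻¹ (W) ≃ₜ W × S` over `W` which is
`S`-equivariant. -/
def IsPrincipalBundle {P : Type u} {B : Type v} [Group P] [TopologicalSpace P]
    [TopologicalSpace B] (S : Subgroup P) (p : P → B) : Prop :=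
  ∀ b : B, ∃ t : Bundle.Trivialization S p, b ∈ t.baseSet ∧
    ∀ (g : P) (s : S), p g ∈ t.baseSet → t (g * s) = ((t g).1, (t g).2 * s)

/-! ### Transformation groups -/

section TransformationGroup

variable (G : Type u) {M : Type v} [Group G] [TopologicalSpace G] [IsTopologicalGroup G]
  [TopologicalSpace M] [MulAction G M]

/-- `H₀`: the connected component of the unit element in the subgroup `H` (with the subspace
topology), as a subgroup of `G`. -/
def identityComponent {G : Type u} [Group G] [TopologicalSpace G] [IsTopologicalGroup G]
    (H : Subgroup G) : Subgroup G :=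
  (Subgroup.connectedComponentOfOne H).map H.subtype

/-- `G_K(N) = G_K ∩ G_{M ∖ N}`, where `G_K` is the subgroup of elements fixing `K` pointwise. -/
def relSubgroup (K N : Set M) : Subgroup G :=
  fixingSubgroup G K ⊓ fixingSubgroup G Nᶜ

/-- The support of `g`: the closure of the set of points moved by `g`. -/
def actionSupport {G : Type u} {M : Type v} [Group G] [TopologicalSpace M] [MulAction G M]
    (g : G) : Set M :=
  closure {x : M | g • x ≠ x}

/-- `G^{c*}_0`: the elements `h` of compact support lying in `G(K)₀` for some compact subset `K`
of `M`. -/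
def compactIdentitySet (M : Type v) [TopologicalSpace M] [MulAction G M] : Set G :=
  {h | IsCompact (actionSupport (M := M) h) ∧
    ∃ K : Set M, IsCompact K ∧ h ∈ identityComponent (relSubgroup G (∅ : Set M) K)}

theorem identityComponent_mono {G : Type u} [Group G] [TopologicalSpace G] [IsTopologicalGroup G]
    {H H' : Subgroup G} (h : H ≤ H') : identityComponent H ≤ identityComponent H' := by
  rintro _ ⟨x, hx, rfl⟩
  have hc : Continuous (Subgroup.inclusion h) := Continuous.subtype_mk continuous_subtype_val _
  exact ⟨Subgroup.inclusion h x, hc.image_connectedComponent_subset 1 ⟨x, hx, rfl⟩, rfl⟩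

theorem compactIdentitySet_subset (M : Type v) [TopologicalSpace M] [MulAction G M] :
    compactIdentitySet G M ⊆ identityComponent (⊤ : Subgroup G) := by
  rintro h ⟨-, K, -, hK⟩
  exact identityComponent_mono le_top hK

/-- `(G, M)` has a weak topology: each neighbourhood of `e` in `G` contains `G_K` for some
compact subset `K` of `M`. -/
def HasWeakTopology (M : Type v) [TopologicalSpace M] [MulAction G M] : Prop :=
  ∀ W ∈ 𝓝 (1 : G), ∃ K : Set M, IsCompact K ∧ (fixingSubgroup G K : Set G) ⊆ W

/-- The set `ℰ^G_K(L, N) = {g|_L : L → M | g ∈ G_K(N)}`. -/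
def EmbeddingSpace (K L N : Set M) : Type v :=
  Set.range fun (g : relSubgroup G K N) (x : L) => (g : G) • (x : M)

namespace EmbeddingSpace

/-- The restriction map `r : G_K(N) → ℰ^G_K(L, N)`, `r(g) = g|_L`. -/
def res (K L N : Set M) (g : relSubgroup G K N) : EmbeddingSpace G K L N :=
  ⟨fun x => (g : G) • (x : M), g, rfl⟩

/-- `ℰ^G_K(L, N)` carries the quotient topology induced by the restriction map. -/
instance (K L N : Set M) : TopologicalSpace (EmbeddingSpace G K L N) :=
  TopologicalSpace.coinduced (res G K L N) inferInstance

theorem continuous_res (K L N : Set M) : Continuous (res G K L N) :=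
  continuous_coinduced_rng

theorem res_surjective (K L N : Set M) : Function.Surjective (res G K L N) := by
  rintro ⟨_, g, rfl⟩
  exact ⟨g, rfl⟩

/-- `ℰ^G_K(L, N)₀`: the connected component of the inclusion `i_L = r(e)`. -/
def component (K L N : Set M) : Set (EmbeddingSpace G K L N) :=
  connectedComponent (res G K L N 1)

theorem res_mem_component (K L N : Set M) {g : relSubgroup G K N}
    (hg : g ∈ Subgroup.connectedComponentOfOne (relSubgroup G K N)) :
    res G K L N g ∈ component G K L N :=
  (continuous_res G K L N).image_connectedComponent_subset 1 ⟨g, hg, rfl⟩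

/-- The restriction map `G_K(N)₀ → ℰ^G_K(L, N)₀`. -/
def resComponent (K L N : Set M) (g : identityComponent (relSubgroup G K N)) :
    component G K L N :=
  ⟨res G K L N ⟨g, by obtain ⟨_, x, _, rfl⟩ := g; exact x.2⟩, by
    obtain ⟨_, x, hx, rfl⟩ := g
    exact res_mem_component G K L N hx⟩

theorem relSubgroup_mono (K : Set M) {N N' : Set M} (h : N ⊆ N') :
    relSubgroup G K N ≤ relSubgroup G K N' :=
  inf_le_inf le_rfl (fixingSubgroup_antitone G M (compl_subset_compl.2 h))

/-- The inclusion `ℰ^G_K(L, N) ⊆ ℰ^G_K(L, N')` for `N ⊆ N'`. -/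
def incl (K L : Set M) {N N' : Set M} (h : N ⊆ N') (f : EmbeddingSpace G K L N) :
    EmbeddingSpace G K L N' :=
  ⟨f.1, by
    obtain ⟨_, g, rfl⟩ := f
    exact ⟨⟨g, relSubgroup_mono G K h g.2⟩, rfl⟩⟩

theorem continuous_incl (K L : Set M) {N N' : Set M} (h : N ⊆ N') :
    Continuous (incl G K L h) :=
  continuous_coinduced_dom.2 <| (continuous_res G K L N').comp
    (f := Subgroup.inclusion (relSubgroup_mono G K h))
    (Continuous.subtype_mk continuous_subtype_val _)

/-- The inclusion `ℰ^G_K(L, N)₀ ⊆ ℰ^G_K(L, N')₀` for `N ⊆ N'`. -/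
def inclComponent (K L : Set M) {N N' : Set M} (h : N ⊆ N') (f : component G K L N) :
    component G K L N' :=
  ⟨incl G K L h f, (continuous_incl G K L h).image_connectedComponent_subset _ ⟨f, f.2, rfl⟩⟩

end EmbeddingSpace

/-- An exhausting sequence of `M`, with the convention `M₀ = ∅`. -/
structure IsExhaustingSequence {M : Type v} [TopologicalSpace M] (Ms : ℕ → Set M) : Prop where
  zero : Ms 0 = ∅
  isCompact : ∀ i, IsCompact (Ms i)
  subset_interior : ∀ i, Ms i ⊆ interior (Ms (i + 1))
  iUnion_eq : ⋃ i, Ms i = univ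

/-- `𝒢^i_{k,j} = G_{M_k}(U_j)₀ ∩ G_{M_i}`, where `U_j = Int M_j`. -/
def structureGroup (Ms : ℕ → Set M) (k i j : ℕ) : Subgroup G :=
  identityComponent (relSubgroup G (Ms k) (interior (Ms j))) ⊓ fixingSubgroup G (Ms i)

/-- The standing assumption on `(G, M, {M_i})`; here `U_j = Int M_j`. In the last three fields
`𝒰^i_{k,j} = ℰ^G_{M_k}(M_i, U_j)₀` is an open subspace of `ℰ^G_{M_k}(M_i, M)₀`, these subspaces
for `j > i` cover it, and the closure of each is contained in the next. -/
structure BundleANRAssumption (Ms : ℕ → Set M) : Prop where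
  metrizable : TopologicalSpace.MetrizableSpace G
  weak : HasWeakTopology G M
  bundle : ∀ k i j, k < i → i < j →
    IsPrincipalBundle
      ((structureGroup G Ms k i j).subgroupOf
        (identityComponent (relSubgroup G (Ms k) (interior (Ms j)))))
      (EmbeddingSpace.resComponent G (Ms k) (Ms i) (interior (Ms j)))
  anr : ∀ i, 1 ≤ i → IsANR (identityComponent (relSubgroup G (∅ : Set M) (interior (Ms i))))
  isOpenEmbedding : ∀ k i j, k < i → i < j →
    IsOpenEmbedding (EmbeddingSpace.inclComponent G (Ms k) (Ms i) (subset_univ (interior (Ms j))))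
  iUnion_range : ∀ k i, k < i →
    ⋃ j ∈ Ioi i, range
      (EmbeddingSpace.inclComponent G (Ms k) (Ms i) (subset_univ (interior (Ms j)))) = univ
  closure_subset : ∀ k i j, k < i → i < j →
    closure (range
      (EmbeddingSpace.inclComponent G (Ms k) (Ms i) (subset_univ (interior (Ms j))))) ⊆
    range (EmbeddingSpace.inclComponent G (Ms k) (Ms i) (subset_univ (interior (Ms (j + 1)))))

end TransformationGroup

/-!
# Identity components of transformation groups: ARs, ANRs and homotopy density

Everything rests on approximating `h ∈ G₀` by elements of `⋃ⱼ G(Uⱼ)₀` which agree with `h` on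
larger and larger `Mᵢ`; by the weak topology, agreeing with `h` on `Mᵢ` for a large `i` means being
close to `h`. If `Φ₀, Φ₁, …` are homotopies, each starting where the previous one ends, and `Φᵢ`
agrees on `Mᵢ` with a given map `f` on a closed set `B`, they can be run through faster and faster
near `B`, and the result extends `f` (`exists_telescope`). An extension theorem with target `G₀`
is such a sequence; homotopy density is the extension theorem for the projection
`G₀ × {0} → G₀`, provided that the values of the `Φᵢ` lie in `⋃ⱼ G(Uⱼ)₀`.

The approximations are lifts along the restriction maps. These have local sections by the bundle
assumption, and local lifts are patched when the structure group is contractible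
(`exists_continuous_lift`, after Dold). The patching is transfinite, over a locally finite cover of
a paracompact space, and is done once and for all in `exists_section_near`. Working in the source
of the lifts, a metrizable space, one never needs that the embedding spaces are metrizable. Since
`G(Uⱼ)₀` grows with `j`, the lifts over the pieces of an increasing open cover are moreover
corrected one after the other (`exists_leveled_lift`).

* Part (1). The connected structure groups are the groups `G_{M_i}(U_j)₀`, so they are contractible;
  as fibres of bundles whose total space is an ANR they are ARs. Each `h ∈ G₀` is an infinite
  product `v₀ v₁ v₂ ⋯` with `vᵢ` in `⋃ⱼ G_{M_i}(U_j)₀` depending continuously on `h`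
  (`BundleANRAssumption.exists_factorization`). The factors of a map `f : B → G₀` are extended
  separately, and the partial products, joined by homotopies `1 ≃ vᵢ`, are the `Φᵢ`.
* Part (2)(i). The embedding space `ℰ_∅(M_i, M)₀` is an absolute neighbourhood extensor, as this is
  a local property (Hanner's theorem, again from `exists_section_near`). Its maps lift to `G₀`,
  because the fibre `G_{M_i}` is contractible, so the restriction of `f` to `M_i` extends to a
  map near `B` with values in `G₀`; two consecutive ones are homotopic near `B`.
* Part (2)(ii). Lifts and homotopies with `k = 1` push `G_{M_1}` into `⋃ⱼ G(U_j)₀`. A local section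
  of `G₀ → ℰ_∅(M_1, M)₀` carries this deformation to an open subset of `G₀`, and
  `exists_section_near`, applied to paths in `G`, makes the local deformations a global one.
-/

/-! ### Patching local sections over a paracompact space -/

theorem exists_mem_chain_finite_subset {α ι : Type*} {r : α → α → Prop} {c : Set α}
    (hc : IsChain r c) (hne : c.Nonempty) (J : α → Set ι) (hJ : ∀ p q, r p q → J p ⊆ J q)
    {T : Set ι} (hT : T.Finite) (hTJ : T ⊆ ⋃ p ∈ c, J p) : ∃ p ∈ c, T ⊆ J p := by
  induction T, hT using Set.Finite.induction_on with
  | empty => exact ⟨hne.some, hne.some_mem, empty_subset _⟩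
  | insert ha hs ih =>
    obtain ⟨p, hp, hsp⟩ := ih ((subset_insert _ _).trans hTJ)
    obtain ⟨q, hq, haq⟩ := mem_iUnion₂.1 (hTJ (mem_insert _ _))
    rcases eq_or_ne p q with rfl | hpq
    · exact ⟨p, hp, insert_subset haq hsp⟩
    rcases hc hp hq hpq with h | h
    · exact ⟨q, hq, insert_subset haq (hsp.trans (hJ _ _ h))⟩
    · exact ⟨p, hp, insert_subset (hJ _ _ h haq) hsp⟩

/-- A continuous section `fn` of the relation `R` over the open set `dom`, which contains the pieces
`B ∩ C a` of `B` for `a ∈ idx`. The values of `fn` outside `dom` are irrelevant, but they are carried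
along unchanged when a partial section is enlarged. -/
structure PartialSection (Z X ι : Type*) [TopologicalSpace Z] [TopologicalSpace X]
    (B : Set Z) (R : Z → X → Prop) (C : ι → Set Z) where
  idx : Set ι
  dom : Set Z
  fn : Z → X
  isOpen_dom : IsOpen dom
  continuousOn : ContinuousOn fn dom
  rel : ∀ z ∈ dom, R z (fn z)
  subset_dom : ∀ a ∈ idx, B ∩ C a ⊆ dom

/-- Patching: `R z x` says that `x` is an admissible value at `z`. Suppose that near each point of the
closed set `B`, a section given on an open set `N` can be replaced by one which is also defined near
`B` and agrees with the old one on a given closed subset of `N`. Then there is a section on a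
neighbourhood of `B`. -/
theorem exists_section_near {Z X : Type*} [TopologicalSpace Z] [ParacompactSpace Z]
    [NormalSpace Z] [TopologicalSpace X] [Nonempty X] {B : Set Z} (hB : IsClosed B)
    {R : Z → X → Prop}
    (h : ∀ b ∈ B, ∃ O : Set Z, IsOpen O ∧ b ∈ O ∧
      ∀ (N : Set Z) (F : Z → X), IsOpen N → ContinuousOn F N → (∀ z ∈ N, R z (F z)) →
      ∀ K ⊆ N, IsClosed K → ∀ C ⊆ O, IsClosed C →
      ∃ (N' : Set Z) (F' : Z → X), IsOpen N' ∧ B ∩ C ⊆ N' ∧ ContinuousOn F' N' ∧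
        (∀ z ∈ N', R z (F' z)) ∧ ∀ z ∈ K ∩ N', F' z = F z) :
    ∃ (N : Set Z) (F : Z → X), IsOpen N ∧ B ⊆ N ∧ ContinuousOn F N ∧ ∀ z ∈ N, R z (F z) := by
  classical
  choose O hOo hbO hO using fun b : B => h b b.2
  obtain ⟨u, huo, hBu, hulf, huO⟩ := precise_refinement_set hB O hOo
    (fun b hb => mem_iUnion.2 ⟨⟨b, hb⟩, hbO ⟨b, hb⟩⟩)
  obtain ⟨v, hBv, hvo, hvu⟩ := exists_subset_iUnion_closure_subset hB huo
    (fun x _ => hulf.point_finite x) hBu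
  obtain ⟨C, hBC, hCc, hCv⟩ := exists_subset_iUnion_closed_subset hB hvo
    (fun x _ => (hulf.point_finite x).subset fun i hi => hvu i (subset_closure hi)) hBv
  set L : B → Set Z := fun a => closure (v a) with hL
  have hLlf : LocallyFinite L := hulf.subset hvu
  have hCL : ∀ a, C a ⊆ L a := fun a => (hCv a).trans subset_closure
  let r : PartialSection Z X B B R C → PartialSection Z X B B R C → Prop := fun p q =>
    p.idx ⊆ q.idx ∧ ∀ z, (∀ a ∈ q.idx, a ∉ p.idx → z ∉ L a) →
      ((z ∈ p.dom ↔ z ∈ q.dom) ∧ p.fn z = q.fn z)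
  -- a larger partial section may differ from a smaller one, in domain or value, only on the new `L a`
  obtain ⟨m, hm⟩ : ∃ m, ∀ p, r m p → r p m := by
    refine exists_maximal_of_chains_bounded ?_ ?_
    · intro c hc
      rcases c.eq_empty_or_nonempty with rfl | hne
      · exact ⟨⟨∅, ∅, fun _ => Classical.arbitrary X, isOpen_empty, continuousOn_empty _,
          by simp, by simp⟩, by simp⟩
      set J : Set B := ⋃ p ∈ c, p.idx with hJ
      have key : ∀ T : Set B, T.Finite → T ⊆ J → ∃ p ∈ c, T ⊆ p.idx := fun T hT hTJ =>
        exists_mem_chain_finite_subset hc hne (fun p => p.idx) (fun p q h => h.1) hT hTJ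
      -- the value at `z` is taken from a member of the chain that no longer changes at `z`
      have hpt : ∀ z, ∃ p ∈ c, {a | a ∈ J ∧ z ∈ L a} ⊆ p.idx := fun z =>
        key _ ((hLlf.point_finite z).subset fun a ha => ha.2) fun a ha => ha.1
      choose s hs hsJ using hpt
      have agree : ∀ p ∈ c, ∀ z, {a | a ∈ J ∧ z ∈ L a} ⊆ p.idx →
          ((z ∈ p.dom ↔ z ∈ (s z).dom) ∧ p.fn z = (s z).fn z) := by
        intro p hp z hz
        rcases eq_or_ne p (s z) with h | hne
        · rw [← h]; simp
        rcases hc hp (hs z) hne with h | h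
        · exact h.2 z fun a ha hap hzL => hap (hz ⟨mem_biUnion (hs z) ha, hzL⟩)
        · have := h.2 z fun a ha hap hzL => hap (hsJ z ⟨mem_biUnion hp ha, hzL⟩)
          exact ⟨this.1.symm, this.2.symm⟩
      -- near each point the glued section is one of the sections of the chain
      have loc : ∀ z, ∀ T : Set B, T.Finite → T ⊆ J → ∃ p ∈ c, T ⊆ p.idx ∧ ∃ U ∈ 𝓝 z, ∀ y ∈ U,
          ((y ∈ p.dom ↔ y ∈ (s y).dom) ∧ p.fn y = (s y).fn y) := by
        intro z T hT hTJ
        obtain ⟨U, hU, hfin⟩ := hLlf z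
        obtain ⟨p, hp, hpJ⟩ := key ({a | a ∈ J ∧ (L a ∩ U).Nonempty} ∪ T)
          ((hfin.subset fun a ha => ha.2).union hT) (union_subset (fun a ha => ha.1) hTJ)
        exact ⟨p, hp, subset_union_right.trans hpJ, U, hU, fun y hy => agree p hp y
          fun a ha => hpJ (Or.inl ⟨ha.1, y, ha.2, hy⟩)⟩
      refine ⟨⟨J, {z | z ∈ (s z).dom}, fun z => (s z).fn z, ?_, ?_, ?_, ?_⟩, ?_⟩
      · rw [isOpen_iff_mem_nhds]
        intro z hz
        obtain ⟨p, hp, -, U, hU, hUp⟩ := loc z ∅ finite_empty (empty_subset _)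
        have hzp : z ∈ p.dom := (hUp z (mem_of_mem_nhds hU)).1.2 hz
        filter_upwards [hU, p.isOpen_dom.mem_nhds hzp] with y hy hyp
        exact (hUp y hy).1.1 hyp
      · intro z hz
        obtain ⟨p, hp, -, U, hU, hUp⟩ := loc z ∅ finite_empty (empty_subset _)
        have hzp : z ∈ p.dom := (hUp z (mem_of_mem_nhds hU)).1.2 hz
        refine ContinuousAt.continuousWithinAt ?_
        refine (p.continuousOn.continuousAt (p.isOpen_dom.mem_nhds hzp)).congr ?_
        filter_upwards [hU] with y hy using (hUp y hy).2
      · intro z hz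
        exact (s z).rel z hz
      · rintro a ha z ⟨hzB, hzC⟩
        obtain ⟨p, hp, hap, U, hU, hUp⟩ := loc z {a} (finite_singleton a)
          (singleton_subset_iff.2 ha)
        exact (hUp z (mem_of_mem_nhds hU)).1.1
          (p.subset_dom a (hap (mem_singleton a)) ⟨hzB, hzC⟩)
      · intro p hp
        refine ⟨subset_biUnion_of_mem (u := fun p : PartialSection Z X B B R C => p.idx) hp,
          fun z hz => agree p hp z fun a ha => ?_⟩
        by_contra hap
        exact hz a ha.1 hap ha.2
    · rintro p q t ⟨h1, h2⟩ ⟨h3, h4⟩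
      refine ⟨h1.trans h3, fun z hz => ?_⟩
      have e1 := h2 z fun a ha hap => hz a (h3 ha) hap
      have e2 := h4 z fun a ha haq => hz a ha fun hap => haq (h1 hap)
      exact ⟨e1.1.trans e2.1, e1.2.trans e2.2⟩
  have hall : ∀ a, a ∈ m.idx := by
    intro a
    by_contra ha
    -- adding `a` leaves the section unchanged on a neighbourhood `V` of the pieces reached so far,
    -- and off `L a`
    have hK0 : IsClosed (⋃ b : B, B ∩ (if b ∈ m.idx then C b else ∅)) := by
      refine LocallyFinite.isClosed_iUnion (hLlf.subset fun b => ?_) fun b => ?_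
      · split_ifs
        · exact inter_subset_right.trans (hCL b)
        · simp
      · split_ifs
        · exact hB.inter (hCc b)
        · simp
    have hK0m : (⋃ b : B, B ∩ (if b ∈ m.idx then C b else ∅)) ⊆ m.dom := by
      refine iUnion_subset fun b => ?_
      split_ifs with hb
      · exact m.subset_dom b hb
      · simp
    obtain ⟨V, hVo, hKV, hVN⟩ := normal_exists_closure_subset hK0 m.isOpen_dom hK0m
    obtain ⟨N', F', hN'o, hBN', hF'c, hF'R, hF'K⟩ := hO a m.dom m.fn m.isOpen_dom m.continuousOn
      m.rel (closure V) hVN isClosed_closure (C a)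
      ((hCv a).trans (subset_closure.trans ((hvu a).trans (huO a)))) (hCc a)
    have hVm : V ⊆ m.dom := subset_closure.trans hVN
    let p : PartialSection Z X B B R C :=
      { idx := insert a m.idx
        dom := (m.dom \ L a) ∪ V ∪ (N' ∩ v a)
        fn := fun z => if z ∈ N' ∩ v a then F' z else m.fn z
        isOpen_dom := ((m.isOpen_dom.sdiff isClosed_closure).union hVo).union (hN'o.inter (hvo a))
        continuousOn := by
          rintro z ((hz | hz) | hz) <;> refine ContinuousAt.continuousWithinAt ?_
          · refine (m.continuousOn.continuousAt (m.isOpen_dom.mem_nhds hz.1)).congr ?_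
            filter_upwards [(m.isOpen_dom.sdiff isClosed_closure).mem_nhds hz] with y hy
            rw [if_neg fun h => hy.2 (subset_closure h.2)]
          · refine (m.continuousOn.continuousAt (m.isOpen_dom.mem_nhds (hVm hz))).congr ?_
            filter_upwards [hVo.mem_nhds hz] with y hy
            split_ifs with h
            · exact (hF'K y ⟨subset_closure hy, h.1⟩).symm
            · rfl
          · refine (hF'c.continuousAt (hN'o.mem_nhds hz.1)).congr ?_
            filter_upwards [(hN'o.inter (hvo a)).mem_nhds hz] with y hy
            rw [if_pos hy]
        rel := by
          intro z hz
          split_ifs with h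
          · exact hF'R z h.1
          · rcases hz with (hz | hz) | hz
            · exact m.rel z hz.1
            · exact m.rel z (hVm hz)
            · exact absurd hz h
        subset_dom := by
          rintro b hb z hz
          rcases hb with rfl | hb
          · exact Or.inr ⟨hBN' hz, hCv _ hz.2⟩
          · refine Or.inl (Or.inr (hKV (mem_iUnion.2 ⟨b, hz.1, ?_⟩)))
            rw [if_pos hb]
            exact hz.2 }
    have hmp : r m p := by
      refine ⟨subset_insert _ _, fun z hz => ?_⟩
      have hzL : z ∉ L a := hz a (mem_insert _ _) ha
      have hzv : z ∉ v a := fun h => hzL (subset_closure h)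
      refine ⟨⟨fun h => Or.inl (Or.inl ⟨h, hzL⟩), ?_⟩, ?_⟩
      · rintro ((h | h) | h)
        · exact h.1
        · exact hVm h
        · exact absurd h.2 hzv
      · exact (if_neg fun h => hzv h.2).symm
    exact ha ((hm p hmp).1 (mem_insert _ _))
  refine ⟨m.dom, m.fn, m.isOpen_dom, fun b hb => ?_, m.continuousOn, m.rel⟩
  obtain ⟨a, ha⟩ := mem_iUnion.1 (hBC hb)
  exact m.subset_dom a (hall a) ⟨hb, ha⟩

/-! ### Lifting modulo a contractible subgroup -/

theorem exists_unitInterval_bump {Z : Type*} [TopologicalSpace Z] [NormalSpace Z] {K N : Set Z}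
    (hK : IsClosed K) (hN : IsOpen N) (hKN : K ⊆ N) :
    ∃ (l : C(Z, unitInterval)) (D : Set Z), IsClosed D ∧ D ⊆ N ∧ (∀ z ∈ K, l z = 1) ∧
      ∀ z ∉ D, l z = 0 := by
  obtain ⟨V, hVo, hKV, hVN⟩ := normal_exists_closure_subset hK hN hKN
  obtain ⟨f, hf0, hf1, hf⟩ := exists_continuous_zero_one_of_isClosed (hVo.isClosed_compl) hK
    (disjoint_left.2 fun z hz hzK => hz (hKV hzK))
  refine ⟨⟨fun z => ⟨f z, hf z⟩, by fun_prop⟩, closure V, isClosed_closure, hVN, ?_, ?_⟩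
  · exact fun z hz => Subtype.ext (hf1 hz)
  · exact fun z hz => Subtype.ext (hf0 fun h => hz (subset_closure h))

section Contraction

variable {G : Type*} [Group G] [TopologicalSpace G] [IsTopologicalGroup G]

/-- A contractible subgroup can be contracted to `1` with `1` fixed: divide a contraction by its
track of `1`. The contraction is a function on `G × [0, 1]`, with junk values off `S`. -/
theorem exists_contraction (S : Subgroup G) [ContractibleSpace S] :
    ∃ c : G × unitInterval → G, ContinuousOn c ((S : Set G) ×ˢ univ) ∧
      (∀ g ∈ S, ∀ t, c (g, t) ∈ S) ∧ (∀ g, c (g, 0) = 1) ∧ (∀ g ∈ S, c (g, 1) = g) ∧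
      ∀ t, c (1, t) = 1 := by
  classical
  obtain ⟨p, ⟨H⟩⟩ := id_nullhomotopic S
  have H0 : ∀ s : S, H (0, s) = s := fun s => H.apply_zero s
  have H1 : ∀ s : S, H (1, s) = p := fun s => H.apply_one s
  let k : S × unitInterval → S := fun q => (H (unitInterval.symm q.2, 1))⁻¹ *
    H (unitInterval.symm q.2, q.1)
  have hk : Continuous k := by
    have h1 : Continuous fun q : S × unitInterval => H (unitInterval.symm q.2, 1) :=
      H.continuous.comp (by fun_prop)
    have h2 : Continuous fun q : S × unitInterval => H (unitInterval.symm q.2, q.1) :=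
      H.continuous.comp (by fun_prop)
    exact h1.inv.mul h2
  refine ⟨fun q => if h : q.1 ∈ S then k (⟨q.1, h⟩, q.2) else 1, ?_, ?_, ?_, ?_, ?_⟩
  · rw [continuousOn_iff_continuous_domRestrict]
    have : Continuous fun q : ((S : Set G) ×ˢ (univ : Set unitInterval) :
        Set (G × unitInterval)) => ((k (⟨q.1.1, q.2.1⟩, q.1.2) : S) : G) :=
      continuous_subtype_val.comp (hk.comp (by fun_prop))
    refine this.congr fun q => ?_
    have hq : q.1.1 ∈ S := q.2.1
    simp [hq]
  · intro g hg t
    simp [hg]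
  · intro g
    by_cases h : g ∈ S <;> simp [h, k, H1]
  · intro g hg
    simp [hg, k, H0]
  · intro t
    have h1 : (⟨1, S.one_mem⟩ : S) = 1 := rfl
    simp [one_mem, k, h1]

/-- Two lifts `τ` and `ℓ` which differ by elements of a contractible subgroup can be interpolated to a
lift on the domain of `τ` which equals `ℓ` on a given closed subset of the domain of `ℓ`. -/
theorem exists_blend {Z : Type*} [TopologicalSpace Z] [NormalSpace Z] (S : Subgroup G)
    [ContractibleSpace S] {O N K : Set Z} (hO : IsOpen O) (hN : IsOpen N) (hK : IsClosed K)
    (hKN : K ⊆ N) {τ ℓ : Z → G} (hτ : ContinuousOn τ O) (hℓ : ContinuousOn ℓ N)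
    (hS : ∀ z ∈ O ∩ N, (τ z)⁻¹ * ℓ z ∈ S) :
    ∃ ℓ' : Z → G, ContinuousOn ℓ' O ∧ (∀ z, z ∈ O → (τ z)⁻¹ * ℓ' z ∈ S) ∧
      (∀ z ∈ K ∩ O, ℓ' z = ℓ z) ∧ ∀ z, (z ∈ N → τ z = ℓ z) → ℓ' z = τ z := by
  classical
  obtain ⟨c, hc, hcS, hc0, hc1, hcone⟩ := exists_contraction S
  obtain ⟨l, D, hD, hDN, hl1, hl0⟩ := exists_unitInterval_bump hK hN hKN
  refine ⟨fun z => if z ∈ N then τ z * c ((τ z)⁻¹ * ℓ z, l z) else τ z, ?_, ?_, ?_, ?_⟩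
  · intro z hz
    refine ContinuousAt.continuousWithinAt ?_
    have hτz := hτ.continuousAt (hO.mem_nhds hz)
    by_cases hzN : z ∈ N
    · have hON : O ∩ N ∈ 𝓝 z := (hO.inter hN).mem_nhds ⟨hz, hzN⟩
      have h1 : ContinuousOn (fun z => τ z * c ((τ z)⁻¹ * ℓ z, l z)) (O ∩ N) := by
        refine (hτ.mono inter_subset_left).mul (hc.comp (f := fun z => ((τ z)⁻¹ * ℓ z, l z)) ?_ ?_)
        · exact ((hτ.mono inter_subset_left).inv.mul (hℓ.mono inter_subset_right)).prodMk
            l.continuous.continuousOn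
        · exact fun z hz => ⟨hS z hz, mem_univ _⟩
      refine (h1.continuousAt hON).congr ?_
      filter_upwards [hN.mem_nhds hzN] with y hy
      rw [if_pos hy]
    · refine hτz.congr ?_
      filter_upwards [hD.isOpen_compl.mem_nhds fun h => hzN (hDN h)] with y hy
      rw [hl0 y hy, hc0, mul_one, ite_self]
  · intro z hz
    dsimp only
    split_ifs with h
    · simpa using hcS _ (hS z ⟨hz, h⟩) _
    · simp
  · rintro z ⟨hz, hzO⟩
    dsimp only
    rw [if_pos (hKN hz), hl1 z hz, hc1 _ (hS z ⟨hzO, hKN hz⟩)]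
    simp
  · intro z hz
    dsimp only
    split_ifs with h
    · simp [← hz h, hcone]
    · rfl

/-- Dold's theorem for principal bundles with contractible structure group, stated for cosets: if the
coset-valued function `z ↦ c z * S` has continuous representatives locally, it has a global one. The
function `c` itself need not be continuous. -/
theorem exists_continuous_lift {Z : Type*} [TopologicalSpace Z]
    [TopologicalSpace.MetrizableSpace Z] (S : Subgroup G)
    [ContractibleSpace S] (c : Z → G)
    (h : ∀ z, ∃ O ∈ 𝓝 z, ∃ τ : Z → G, ContinuousOn τ O ∧ ∀ y ∈ O, (c y)⁻¹ * τ y ∈ S) :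
    ∃ ℓ : Z → G, Continuous ℓ ∧ ∀ z, (c z)⁻¹ * ℓ z ∈ S := by
  let _ := TopologicalSpace.metrizableSpaceMetric Z
  obtain ⟨N, F, -, hN, hF, hFS⟩ := exists_section_near (isClosed_univ (X := Z))
    (R := fun z x => (c z)⁻¹ * x ∈ S) (fun z _ => by
      obtain ⟨O, hO, τ, hτ, hτS⟩ := h z
      refine ⟨interior O, isOpen_interior, mem_interior_iff_mem_nhds.2 hO,
        fun N F hN hF hFS K hKN hK C hCO _ => ?_⟩
      have key : ∀ y, (c y)⁻¹ * τ y ∈ S → ∀ x, (τ y)⁻¹ * x ∈ S ↔ (c y)⁻¹ * x ∈ S := fun y hy x => by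
        rw [← S.mul_mem_cancel_left hy]
        group
      obtain ⟨ℓ, hℓ, hℓS, hℓK, -⟩ := exists_blend S (τ := τ) (ℓ := F) isOpen_interior hN hK hKN
        (hτ.mono interior_subset) hF
        (fun y hy => (key y (hτS y (interior_subset hy.1)) _).2 (hFS y hy.2))
      exact ⟨interior O, ℓ, isOpen_interior, by simpa using hCO, hℓ, fun y hy =>
        (key y (hτS y (interior_subset hy)) _).1 (hℓS y hy), hℓK⟩)
  rw [univ_subset_iff] at hN
  subst hN
  exact ⟨F, continuousOn_univ.1 hF, fun z => hFS z (mem_univ z)⟩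

end Contraction

/-! ### Constructions along an increasing open cover -/

theorem exists_nested_isClosed {Z : Type*} [TopologicalSpace Z]
    [TopologicalSpace.MetrizableSpace Z] {O : ℕ → Set Z} (hO : ∀ n, IsOpen (O n))
    (hmono : Monotone O) (hU : ⋃ n, O n = univ) :
    ∃ C : ℕ → Set Z, (∀ n, IsClosed (C n)) ∧ (∀ n, C n ⊆ O n) ∧
      (∀ n, C n ⊆ interior (C (n + 1))) ∧ ⋃ n, C n = univ := by
  let _ := TopologicalSpace.metrizableSpaceMetric Z
  -- `C n` is the set of points at distance at least `ε n` from the complement of `O n`; extended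
  -- distances are used because that complement may be empty
  let ε : ℕ → ENNReal := fun n => ((n : ENNReal) + 1)⁻¹
  have hε : ∀ n, 0 < ε n := fun n => by
    simp only [ε, ENNReal.inv_pos]
    exact ENNReal.add_ne_top.2 ⟨ENNReal.natCast_ne_top n, ENNReal.one_ne_top⟩
  have hεlt : ∀ n, ε (n + 1) < ε n := fun n => by
    simp only [ε]
    rw [ENNReal.inv_lt_inv]
    exact_mod_cast Nat.lt_succ_self (n + 1)
  have hcont : ∀ n, Continuous fun z => Metric.infEDist z (O n)ᶜ := fun n =>
    Metric.continuous_infEDist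
  refine ⟨fun n => {z | ε n ≤ Metric.infEDist z (O n)ᶜ}, fun n =>
    isClosed_le continuous_const (hcont n), fun n z hz => ?_, fun n => ?_, ?_⟩
  · by_contra h
    have h0 : Metric.infEDist z (O n)ᶜ = 0 := Metric.infEDist_zero_of_mem h
    rw [mem_ofPred_eq, h0] at hz
    exact absurd (hε n) (not_lt.2 hz)
  · have hsub : {z | ε (n + 1) < Metric.infEDist z (O (n + 1))ᶜ} ⊆
        {z | ε (n + 1) ≤ Metric.infEDist z (O (n + 1))ᶜ} := by
      intro z hz
      rw [mem_ofPred_eq] at hz ⊢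
      exact hz.le
    refine Subset.trans ?_ (interior_maximal hsub (isOpen_lt continuous_const (hcont (n + 1))))
    intro z hz
    exact (hεlt n).trans_le (le_trans hz
      (Metric.infEDist_anti (compl_subset_compl.2 (hmono (Nat.le_succ n)))))
  · rw [eq_univ_iff_forall]
    intro z
    obtain ⟨n, hn⟩ := mem_iUnion.1 (hU ▸ mem_univ z)
    have hpos : 0 < Metric.infEDist z (O n)ᶜ := by
      rw [pos_iff_ne_zero]
      intro h0
      exact ((Metric.mem_iff_infEDist_zero_of_closed (hO n).isClosed_compl).2 h0) hn
    obtain ⟨m, hm⟩ := ENNReal.exists_inv_nat_lt hpos.ne'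
    refine mem_iUnion.2 ⟨max m n, ?_⟩
    calc ε (max m n) ≤ (m : ENNReal)⁻¹ := by
          simp only [ε]
          rw [ENNReal.inv_le_inv]
          exact_mod_cast (le_max_left m n).trans (Nat.le_succ _)
      _ ≤ Metric.infEDist z (O n)ᶜ := hm.le
      _ ≤ _ := Metric.infEDist_anti (compl_subset_compl.2 (hmono (le_max_right m n)))

/-- A sequence of functions with the property `Q`, each agreeing with the previous one on `C n`, has a
limit which is locally one of them. -/
theorem exists_of_nested {Z X : Type*} [TopologicalSpace Z] {C : ℕ → Set Z}
    (hC : ∀ n, C n ⊆ interior (C (n + 1))) (hU : ⋃ n, C n = univ) (Q : ℕ → (Z → X) → Prop)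
    (h0 : ∃ f, Q 0 f)
    (hs : ∀ n f, Q n f → ∃ f', Q (n + 1) f' ∧ ∀ z ∈ C n, f' z = f z) :
    ∃ F : Z → X, ∀ z, ∃ n f, Q n f ∧ z ∈ interior (C n) ∧ ∀ y ∈ C n, F y = f y := by
  classical
  have hmono : Monotone C := monotone_nat_of_le_succ fun n => (hC n).trans interior_subset
  choose! g hg hgC using hs
  obtain ⟨f0, hf0⟩ := h0
  let s : ℕ → (Z → X) := fun n => Nat.rec f0 (fun n f => g n f) n
  have hsQ : ∀ n, Q n (s n) := fun n => by
    induction n with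
    | zero => exact hf0
    | succ n ih => exact hg n _ ih
  have hsC : ∀ n m, n ≤ m → ∀ z ∈ C n, s m z = s n z := fun n m h => by
    induction m, h using Nat.le_induction with
    | base => exact fun z _ => rfl
    | succ m hm ih =>
      intro z hz
      rw [← ih z hz]
      exact hgC m _ (hsQ m) z (hmono hm hz)
  have hex : ∀ z, ∃ n, z ∈ C n := fun z => mem_iUnion.1 (hU ▸ mem_univ z)
  refine ⟨fun z => s (Nat.find (hex z)) z, fun z => ?_⟩
  obtain ⟨n, hn⟩ := hex z
  exact ⟨n + 1, s (n + 1), hsQ _, hC n hn, fun y hy =>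
    (hsC _ _ (Nat.find_min' (hex y) hy) y (Nat.find_spec (hex y))).symm⟩

/-- Near each point, `f` takes values in one of the subgroups `A n`. For an increasing sequence `A`
it says that `f` maps into `⋃ₙ A n` with a level `n` that is locally bounded. -/
def LocallyIn {Z G : Type*} [TopologicalSpace Z] [Group G] (A : ℕ → Subgroup G) (f : Z → G) :
    Prop :=
  ∀ z, ∃ n, ∀ᶠ y in 𝓝 z, f y ∈ A n

section Levels

variable {G : Type*} [Group G] [TopologicalSpace G] [IsTopologicalGroup G]

/-- Lifts `τ n` over the members of an increasing open cover, with consecutive ones differing by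
elements of contractible groups `S n`, can be corrected to a global lift. The last clause says that
nothing is changed where all the `τ n` agree. -/
theorem exists_leveled_lift {Z : Type*} [TopologicalSpace Z]
    [TopologicalSpace.MetrizableSpace Z] {S : ℕ → Subgroup G} (hS : Monotone S)
    [∀ n, ContractibleSpace (S n)] {O : ℕ → Set Z} (hO : ∀ n, IsOpen (O n))
    (hmono : Monotone O) (hU : ⋃ n, O n = univ) (τ : ℕ → Z → G)
    (hτ : ∀ n, ContinuousOn (τ n) (O n))
    (hτS : ∀ n, ∀ z ∈ O n, (τ (n + 1) z)⁻¹ * τ n z ∈ S (n + 1)) :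
    ∃ ℓ : Z → G, Continuous ℓ ∧
      (∀ z, ∃ n, ∀ᶠ y in 𝓝 z, y ∈ O n ∧ (τ n y)⁻¹ * ℓ y ∈ S n) ∧
      ∀ z x, (∀ n, z ∈ O n → τ n z = x) → ℓ z = x := by
  let _ := TopologicalSpace.metrizableSpaceMetric Z
  obtain ⟨C, hCc, hCO, hC, hCU⟩ := exists_nested_isClosed hO hmono hU
  obtain ⟨ℓ, hℓ⟩ := exists_of_nested hC hCU
    (fun n f => ContinuousOn f (O n) ∧ (∀ z ∈ O n, (τ n z)⁻¹ * f z ∈ S n) ∧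
      ∀ z ∈ O n, ∀ x, (∀ n, z ∈ O n → τ n z = x) → f z = x)
    ⟨τ 0, hτ 0, fun z _ => by simp, fun z hz x h => h 0 hz⟩ (by
      rintro n f ⟨hf, hfS, hfx⟩
      obtain ⟨f', hf', hf'S, hf'C, hf'x⟩ := exists_blend (S (n + 1)) (hO (n + 1)) (hO n) (hCc n)
        (hCO n) (hτ (n + 1)) hf (fun z hz => by
          have := (S (n + 1)).mul_mem (hτS n z hz.2) (hS (Nat.le_succ n) (hfS z hz.2))
          simpa [mul_assoc] using this)
      refine ⟨f', ⟨hf', hf'S, fun z hz x hx => ?_⟩, fun z hz => hf'C z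
        ⟨hz, hmono (Nat.le_succ n) (hCO n hz)⟩⟩
      rw [hf'x z fun hzn => by rw [hx _ hz, hfx z hzn x hx], hx _ hz])
  refine ⟨ℓ, continuous_iff_continuousAt.2 fun z => ?_, fun z => ?_, fun z x hx => ?_⟩
  · obtain ⟨n, f, ⟨hf, -, -⟩, hz, hfC⟩ := hℓ z
    refine (hf.continuousAt ((hO n).mem_nhds (hCO n (interior_subset hz)))).congr ?_
    filter_upwards [mem_interior_iff_mem_nhds.1 hz] with y hy using (hfC y hy).symm
  · obtain ⟨n, f, ⟨-, hf, -⟩, hz, hfC⟩ := hℓ z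
    refine ⟨n, ?_⟩
    filter_upwards [mem_interior_iff_mem_nhds.1 hz] with y hy
    rw [hfC y hy]
    exact ⟨hCO n hy, hf y (hCO n hy)⟩
  · obtain ⟨n, f, ⟨-, -, hf⟩, hz, hfC⟩ := hℓ z
    rw [hfC z (interior_subset hz)]
    exact hf z (hCO n (interior_subset hz)) x hx

end Levels

section LeveledMaps

variable {G : Type u} [Group G] [TopologicalSpace G] [IsTopologicalGroup G]

/-- A map into the union of increasing contractible subgroups, locally of bounded level, is homotopic
to the constant map `1` through such maps. -/
theorem exists_leveled_homotopy {Z : Type*} [TopologicalSpace Z]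
    [TopologicalSpace.MetrizableSpace Z] {S : ℕ → Subgroup G} (hS : Monotone S)
    [∀ n, ContractibleSpace (S n)] {δ : Z → G} (hδ : Continuous δ) (hδS : LocallyIn S δ) :
    ∃ C : Z × unitInterval → G, Continuous C ∧ LocallyIn S C ∧ (∀ z, C (z, 0) = 1) ∧
      ∀ z, C (z, 1) = δ z := by
  choose c hc hcS hc0 hc1 hcone using fun n => exists_contraction (S n)
  let O : ℕ → Set (Z × unitInterval) := fun n => Prod.fst ⁻¹' interior {z | δ z ∈ S n}
  have hO : ∀ n, IsOpen (O n) := fun n => isOpen_interior.preimage continuous_fst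
  have hOS : ∀ n, ∀ q ∈ O n, δ q.1 ∈ S n := fun n q hq =>
    interior_subset (s := {z | δ z ∈ S n}) hq
  -- on level `n` the homotopy is a contraction of `S n`; all of these agree at the times `0` and `1`
  obtain ⟨C, hC, hCS, hCx⟩ := exists_leveled_lift hS hO
    (fun n m h => preimage_mono (interior_mono fun z hz => hS h hz))
    (eq_univ_iff_forall.2 fun q => by
      obtain ⟨n, hn⟩ := hδS q.1
      exact mem_iUnion.2 ⟨n, mem_interior_iff_mem_nhds.2 hn⟩)
    (fun n q => c n (δ q.1, q.2))
    (fun n => (hc n).comp (f := fun q : Z × unitInterval => (δ q.1, q.2))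
      (by fun_prop) fun q hq => ⟨hOS n q hq, mem_univ _⟩)
    (fun n q hq => (S (n + 1)).mul_mem
      ((S (n + 1)).inv_mem (hcS _ _ (hS (Nat.le_succ n) (hOS n q hq)) _))
      (hS (Nat.le_succ n) (hcS _ _ (hOS n q hq) _)))
  refine ⟨C, hC, fun q => ?_, fun z => hCx _ _ fun n _ => hc0 n _,
    fun z => hCx _ _ fun n hz => hc1 n _ (hOS n _ hz)⟩
  obtain ⟨n, hn⟩ := hCS q
  refine ⟨n, hn.mono fun y hy => ?_⟩
  exact ((S n).mul_mem_cancel_left ((S n).inv_mem (hcS n _ (hOS n y hy.1) _))).1 hy.2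

theorem IsAR.exists_extension {X : Type u} [TopologicalSpace X] {A : Set X} (hA : IsAR A)
    {Y : Type u} [TopologicalSpace Y] [TopologicalSpace.MetrizableSpace Y] {D : Set Y}
    (hD : IsClosed D) {f : Y → X} (hf : ContinuousOn f D) (hfA : MapsTo f D A) :
    ∃ F : Y → X, Continuous F ∧ (∀ y, F y ∈ A) ∧ ∀ y ∈ D, F y = f y := by
  obtain ⟨F, hF⟩ := hA.2 Y D hD ⟨hfA.restrict, hf.mapsToRestrict hfA⟩
  exact ⟨fun y => F y, by fun_prop, fun y => (F y).2, fun y hy =>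
    congrArg Subtype.val (hF ⟨y, hy⟩)⟩

/-- The union of an increasing sequence of ARs is an absolute extensor for maps of locally bounded
level. -/
theorem exists_leveled_extension {Y : Type u} [TopologicalSpace Y]
    [TopologicalSpace.MetrizableSpace Y] {A : ℕ → Subgroup G} (hA : Monotone A)
    (hAR : ∀ n, IsAR (A n)) {B : Set Y} (hB : IsClosed B) {f : Y → G} (hf : ContinuousOn f B)
    (hfA : ∀ b ∈ B, ∃ n, ∀ᶠ y in 𝓝[B] b, f y ∈ A n) :
    ∃ F : Y → G, Continuous F ∧ LocallyIn A F ∧ ∀ b ∈ B, F b = f b := by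
  classical
  let O : ℕ → Set Y := fun n => interior {y | y ∈ B → f y ∈ A n}
  have hOA : ∀ n, ∀ y ∈ O n, y ∈ B → f y ∈ A n := fun n y hy =>
    interior_subset (s := {y | y ∈ B → f y ∈ A n}) hy
  obtain ⟨C, hCc, hCO, hC, hCU⟩ := exists_nested_isClosed (O := O) (fun n => isOpen_interior)
    (fun n m h => interior_mono fun y hy hyB => hA h (hy hyB))
    (eq_univ_iff_forall.2 fun y => by
      by_cases hy : y ∈ B
      · obtain ⟨n, hn⟩ := hfA y hy
        exact mem_iUnion.2 ⟨n, mem_interior_iff_mem_nhds.2 (eventually_nhdsWithin_iff.1 hn)⟩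
      · refine mem_iUnion.2 ⟨0, mem_interior_iff_mem_nhds.2 ?_⟩
        filter_upwards [hB.isOpen_compl.mem_nhds hy] with z hz hzB using absurd hzB hz)
  obtain ⟨F, hF⟩ := exists_of_nested hC hCU
    (fun n F => Continuous F ∧ (∀ y, F y ∈ A n) ∧ ∀ y ∈ B ∩ C n, F y = f y)
    (IsAR.exists_extension (hAR 0) (hB.inter (hCc 0)) (hf.mono inter_subset_left)
      fun y hy => hOA 0 y (hCO 0 hy.2) hy.1) (by
    rintro n F ⟨hFc, hFA, hFf⟩
    let g : Y → G := fun y => if y ∈ C n then F y else f y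
    have hg1 : EqOn g F (C n) := fun y hy => if_pos hy
    have hg2 : EqOn g f (B ∩ C (n + 1)) := fun y hy => by
      by_cases h : y ∈ C n
      · exact (if_pos h).trans (hFf y ⟨hy.1, h⟩)
      · exact if_neg h
    obtain ⟨F', hF', hF'A, hF'g⟩ := IsAR.exists_extension (hAR (n + 1))
      ((hCc n).union (hB.inter (hCc (n + 1)))) (f := g)
      (((hFc.continuousOn).congr hg1).union_of_isClosed
        ((hf.mono inter_subset_left).congr hg2) (hCc n) (hB.inter (hCc (n + 1)))) (by
        rintro y (hy | hy)
        · rw [hg1 hy]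
          exact hA (Nat.le_succ n) (hFA y)
        · rw [hg2 hy]
          exact hOA _ y (hCO _ hy.2) hy.1)
    exact ⟨F', ⟨hF', hF'A, fun y hy => (hF'g y (Or.inr hy)).trans (hg2 hy)⟩,
      fun y hy => (hF'g y (Or.inl hy)).trans (hg1 hy)⟩)
  refine ⟨F, continuous_iff_continuousAt.2 fun y => ?_, fun y => ?_, fun b hb => ?_⟩
  · obtain ⟨n, g, ⟨hg, -, -⟩, hy, hgC⟩ := hF y
    refine hg.continuousAt.congr ?_
    filter_upwards [mem_interior_iff_mem_nhds.1 hy] with z hz using (hgC z hz).symm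
  · obtain ⟨n, g, ⟨-, hg, -⟩, hy, hgC⟩ := hF y
    refine ⟨n, ?_⟩
    filter_upwards [mem_interior_iff_mem_nhds.1 hy] with z hz
    rw [hgC z hz]
    exact hg z
  · obtain ⟨n, g, ⟨-, -, hg⟩, hy, hgC⟩ := hF b
    rw [hgC b (interior_subset hy)]
    exact hg b ⟨hb, interior_subset hy⟩

end LeveledMaps

/-! ### Telescopes of homotopies -/

/-- Let `Φ n` be homotopies on neighbourhoods `N n` of `B`, each starting where the previous one ends,
such that on `B` the values of `Φ n` differ from `f` by elements of `H n`, where `H n` shrinks to `1`.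
Running through all the `Φ n` on the way to `B` gives an extension of `f` to `N 0`. -/
theorem exists_telescope {G : Type*} [Group G] [TopologicalSpace G] [IsTopologicalGroup G]
    [FirstCountableTopology G] {Y : Type*} [TopologicalSpace Y]
    [TopologicalSpace.MetrizableSpace Y] {B : Set Y} (hB : IsClosed B) {f : Y → G}
    (hf : ContinuousOn f B) {H : ℕ → Set G} (hH : ∀ W ∈ 𝓝 (1 : G), ∃ n, ∀ m ≥ n, H m ⊆ W)
    {N : ℕ → Set Y} (hN : ∀ n, IsOpen (N n)) (hBN : ∀ n, B ⊆ N n)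
    {Φ : ℕ → Y × unitInterval → G} (hΦ : ∀ n, ContinuousOn (Φ n) (N n ×ˢ univ))
    (hΦs : ∀ n, ∀ y ∈ N n ∩ N (n + 1), Φ n (y, 1) = Φ (n + 1) (y, 0))
    (hΦH : ∀ n, ∀ b ∈ B, ∀ t, (f b)⁻¹ * Φ n (b, t) ∈ H n) :
    ∃ F : Y → G, ContinuousOn F (N 0) ∧ (∀ b ∈ B, F b = f b) ∧
      ∀ y ∈ N 0, y ∉ B → ∃ n t, y ∈ N n ∧ F y = Φ n (y, t) := by
  classical
  let _ := TopologicalSpace.metrizableSpaceMetric Y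
  obtain ⟨Ω, hΩ⟩ := (𝓝 (1 : G)).exists_antitone_basis
  -- `W n`: the points at which `Φ n` is uniformly in time `Ω n`-close to its values at a nearby point
  -- of `B`
  let W : ℕ → Set Y := fun n => {y | y ∈ N n ∧ ∃ b ∈ B, dist y b < 1 / ((n : ℝ) + 1) ∧
    ∀ t, (Φ n (b, t))⁻¹ * Φ n (y, t) ∈ Ω n}
  have hW : ∀ n, B ⊆ interior (W n) := by
    intro n b hb
    rw [mem_interior_iff_mem_nhds]
    have hcont : ∀ t, ContinuousAt (Φ n) (b, t) := fun t => (hΦ n).continuousAt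
      (((hN n).prod isOpen_univ).mem_nhds ⟨hBN n hb, mem_univ t⟩)
    have h1 : ∀ᶠ y in 𝓝 b, ∀ t ∈ (univ : Set unitInterval),
        (Φ n (b, t))⁻¹ * Φ n (y, t) ∈ Ω n := by
      refine isCompact_univ.eventually_forall_of_forall_eventually fun t _ => ?_
      have h2 : ContinuousAt (fun q : Y × unitInterval => (Φ n (b, q.2))⁻¹ * Φ n (q.1, q.2))
          (b, t) :=
        (((hcont t).comp_of_eq (f := fun q : Y × unitInterval => (b, q.2))
          (by fun_prop) rfl).inv).mul (hcont t)
      refine h2.eventually_mem ?_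
      simpa using hΩ.1.mem_of_mem (i := n) trivial
    filter_upwards [h1, (hN n).mem_nhds (hBN n hb), Metric.ball_mem_nhds b
      (show (0 : ℝ) < 1 / ((n : ℝ) + 1) by positivity)] with y hy hyN hyb
    exact ⟨hyN, b, hb, hyb, fun t => hy t (mem_univ t)⟩
  -- neighbourhoods `O n` of `B`, shrinking to `B`, such that `Φ n` can be used on `O n \ O (n + 1)`
  have hstep : ∀ (n : ℕ) (U : {U : Set Y // IsOpen U ∧ B ⊆ U}),
      ∃ V : {U : Set Y // IsOpen U ∧ B ⊆ U}, closure V.1 ⊆ U.1 ∩ interior (W (n + 1)) := by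
    rintro n ⟨U, hU, hBU⟩
    obtain ⟨V, hV, hBV, hVU⟩ := normal_exists_closure_subset hB
      (hU.inter (isOpen_interior (s := W (n + 1)))) (subset_inter hBU (hW (n + 1)))
    exact ⟨⟨V, hV, hBV⟩, hVU⟩
  choose g hg using hstep
  let O' : ℕ → {U : Set Y // IsOpen U ∧ B ⊆ U} := fun n =>
    Nat.rec ⟨N 0, hN 0, hBN 0⟩ (fun n U => g n U) n
  let O : ℕ → Set Y := fun n => (O' n).1
  have hO : ∀ n, IsOpen (O n) := fun n => (O' n).2.1
  have hBO : ∀ n, B ⊆ O n := fun n => (O' n).2.2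
  have hcl : ∀ n, closure (O (n + 1)) ⊆ O n ∩ interior (W (n + 1)) := fun n => hg n (O' n)
  have hOsucc : ∀ n, O (n + 1) ⊆ O n := fun n =>
    subset_closure.trans ((hcl n).trans inter_subset_left)
  have hOanti : Antitone O := antitone_nat_of_succ_le hOsucc
  have hOW : ∀ n, 1 ≤ n → O n ⊆ W n := by
    intro n hn
    obtain ⟨m, rfl⟩ := Nat.exists_eq_add_of_le' hn
    exact subset_closure.trans ((hcl m).trans (inter_subset_right.trans interior_subset))
  have hON : ∀ n, O n ⊆ N n := by
    intro n
    rcases n with _ | n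
    · exact subset_rfl
    · exact fun y hy => (hOW (n + 1) (Nat.succ_pos n) hy).1
  have hclN : ∀ n, closure (O (n + 1)) ⊆ N (n + 1) := fun n y hy =>
    (interior_subset ((hcl n) hy).2).1
  choose l D hD hDO hl1 hl0 using fun n => exists_unitInterval_bump
    (isClosed_closure (s := O (n + 1))) (hO n) ((hcl n).trans inter_subset_left)
  -- `Fn n` runs through `Φ i` on `O i \ O (i + 1)` for `i < n`, and stops at the end of `Φ n`
  let Fn : ℕ → Y → G := fun n => Nat.rec (fun y => Φ 0 (y, l 0 y))
    (fun n F y => if y ∈ closure (O (n + 1)) then Φ (n + 1) (y, l (n + 1) y) else F y) n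
  have hF0 : ∀ y, Fn 0 y = Φ 0 (y, l 0 y) := fun y => rfl
  have hFpos : ∀ n, ∀ y ∈ closure (O (n + 1)), Fn (n + 1) y = Φ (n + 1) (y, l (n + 1) y) :=
    fun n y hy => if_pos hy
  have hFneg : ∀ n, ∀ y ∉ closure (O (n + 1)), Fn (n + 1) y = Fn n y := fun n y hy => if_neg hy
  have hFone : ∀ n, ∀ y ∈ closure (O (n + 1)), Fn n y = Φ n (y, 1) := by
    rintro (_ | n) y hy
    · rw [hF0, hl1 0 y hy]
    · rw [hFpos n y (subset_closure ((hcl (n + 1)) hy).1), hl1 _ y hy]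
  have hΦl : ∀ n, ContinuousOn (fun y => Φ n (y, l n y)) (N n) := fun n =>
    (hΦ n).comp (f := fun y => (y, l n y)) (by fun_prop) fun y hy => ⟨hy, mem_univ _⟩
  have hFneg' : ∀ n, ∀ y ∈ (O (n + 1))ᶜ, Fn (n + 1) y = Fn n y := by
    intro n y hy
    by_cases hyc : y ∈ closure (O (n + 1))
    · rw [hFpos n y hyc, hl0 _ y fun h => hy (hDO _ h), hFone n y hyc]
      exact (hΦs n y ⟨hON n ((hcl n) hyc).1, hclN n hyc⟩).symm
    · exact hFneg n y hyc
  have hFc : ∀ n, ContinuousOn (Fn n) (O 0) := by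
    intro n
    induction n with
    | zero => exact hΦl 0
    | succ n ih =>
      intro y hy
      by_cases hyc : y ∈ closure (O (n + 1))
      · have h1 : ContinuousWithinAt (Fn (n + 1)) (closure (O (n + 1))) y :=
          ((hΦl (n + 1)).mono (hclN n)).congr (fun z hz => hFpos n z hz) y hyc
        have h2 : ContinuousWithinAt (Fn (n + 1)) (O (n + 1))ᶜ y := by
          by_cases hyO : y ∈ O (n + 1)
          · refine continuousWithinAt_of_notMem_closure ?_
            rw [(hO (n + 1)).isClosed_compl.closure_eq]
            exact fun h => h hyO
          · exact ((ih.continuousAt ((hO 0).mem_nhds hy)).continuousWithinAt).congr (hFneg' n)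
              (hFneg' n y hyO)
        refine (h1.union h2).mono fun z _ => ?_
        by_cases hz : z ∈ O (n + 1)
        · exact Or.inl (subset_closure hz)
        · exact Or.inr hz
      · refine ContinuousAt.continuousWithinAt ?_
        refine (ih.continuousAt ((hO 0).mem_nhds hy)).congr ?_
        filter_upwards [isClosed_closure.isOpen_compl.mem_nhds hyc] with z hz
        exact (hFneg n z hz).symm
  have hclanti : ∀ n m, n ≤ m → closure (O m) ⊆ closure (O n) := fun n m h =>
    closure_mono (hOanti h)
  have hstable : ∀ n m, n ≤ m → ∀ y ∉ closure (O (n + 1)), Fn m y = Fn n y := by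
    intro n m h y hy
    induction m, h using Nat.le_induction with
    | base => rfl
    | succ m hm ih => rw [hFneg m y fun h => hy (hclanti _ _ (Nat.succ_le_succ hm) h), ih]
  have hval : ∀ n, ∀ y ∈ O 0, ∃ i t, y ∈ O i ∧ (i = n ∨ y ∉ O (i + 1)) ∧ Fn n y = Φ i (y, t) := by
    intro n y hy
    induction n with
    | zero => exact ⟨0, _, hy, Or.inl rfl, hF0 y⟩
    | succ n ih =>
      by_cases hyO : y ∈ O (n + 1)
      · exact ⟨n + 1, _, hyO, Or.inl rfl, hFpos n y (subset_closure hyO)⟩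
      · obtain ⟨i, t, hi, h, hF⟩ := ih
        refine ⟨i, t, hi, Or.inr ?_, by rw [hFneg' n y hyO, hF]⟩
        rcases h with rfl | h
        · exact hyO
        · exact h
  have hout : ∀ y, y ∉ B → ∃ n, y ∉ closure (O (n + 1)) := by
    intro y hy
    by_contra! h
    refine hy (hB.closure_subset (Metric.mem_closure_iff.2 fun ε hε => ?_))
    obtain ⟨n, hn⟩ := exists_nat_one_div_lt hε
    obtain ⟨-, b, hb, hd, -⟩ := interior_subset ((hcl n) (h n)).2
    refine ⟨b, hb, hd.trans (lt_trans ?_ hn)⟩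
    push_cast
    exact one_div_lt_one_div_of_lt (by positivity) (by linarith)
  choose! k hk using hout
  have hBout : ∀ n, ∀ y ∉ closure (O n), y ∉ B := fun n y hy hyB => hy (subset_closure (hBO n hyB))
  have hFval : ∀ y ∈ O 0, y ∉ B → ∃ i t, y ∈ O i ∧ y ∉ O (i + 1) ∧ Fn (k y) y = Φ i (y, t) := by
    intro y hy hyB
    obtain ⟨i, t, hi, h, hF⟩ := hval (k y) y hy
    refine ⟨i, t, hi, ?_, hF⟩
    rcases h with rfl | h
    · exact fun h => hk y hyB (subset_closure h)
    · exact h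
  refine ⟨fun y => if y ∈ B then f y else Fn (k y) y, fun y hy => ?_, fun b hb => if_pos hb,
    fun y hy hyB => ?_⟩
  · refine ContinuousAt.continuousWithinAt ?_
    by_cases hyB : y ∈ B
    · rw [ContinuousAt, if_pos hyB]
      intro U hU
      have hmul : Filter.Tendsto (fun q : G × G × G => q.1 * q.2.1 * q.2.2) (𝓝 (f y, 1, 1))
          (𝓝 (f y)) := by
        have : Continuous fun q : G × G × G => q.1 * q.2.1 * q.2.2 := by fun_prop
        simpa using this.tendsto (f y, 1, 1)
      obtain ⟨V, hV, V', hV', hVU⟩ := mem_nhds_prod_iff.1 (hmul hU)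
      obtain ⟨V₁, hV₁, V₂, hV₂, hV12⟩ := mem_nhds_prod_iff.1 hV'
      have hprod : ∀ x ∈ V, ∀ a ∈ V₁, ∀ b ∈ V₂, x * a * b ∈ U := fun x hx a ha b hb =>
        hVU (mk_mem_prod hx (hV12 (mk_mem_prod ha hb)))
      obtain ⟨m₁, hm₁⟩ := hH V₁ hV₁
      obtain ⟨m₂, -, hm₂⟩ := hΩ.1.mem_iff.1 hV₂
      obtain ⟨ε, hε, hεV⟩ := Metric.mem_nhdsWithin_iff.1 (hf y hyB hV)
      obtain ⟨m₃, hm₃⟩ := exists_nat_one_div_lt (half_pos hε)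
      let m := max 1 (max m₁ (max m₂ m₃))
      rw [Filter.mem_map]
      filter_upwards [(hO m).mem_nhds (hBO m hyB), (hO 0).mem_nhds hy,
        Metric.ball_mem_nhds y (half_pos hε)] with z hzm hz0 hzy
      rw [Metric.mem_ball] at hzy
      rw [mem_preimage]
      split_ifs with hzB
      · have h1 : f z ∈ V := hεV ⟨Metric.mem_ball.2 (hzy.trans (half_lt_self hε)), hzB⟩
        simpa using hprod _ h1 1 (mem_of_mem_nhds hV₁) 1 (mem_of_mem_nhds hV₂)
      · obtain ⟨i, t, hi, hi', hF⟩ := hFval z hz0 hzB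
        have him : m ≤ i := by
          by_contra! h
          exact hi' (hOanti h hzm)
        obtain ⟨-, b, hb, hd, hbt⟩ := hOW i ((le_max_left _ _).trans him) hi
        have h3 : m₃ ≤ i :=
          (le_max_right _ _).trans ((le_max_right _ _).trans ((le_max_right _ _).trans him))
        have h2 : m₂ ≤ i :=
          (le_max_left _ _).trans ((le_max_right _ _).trans ((le_max_right _ _).trans him))
        have h1 : m₁ ≤ i := (le_max_left _ _).trans ((le_max_right _ _).trans him)
        have hd' : dist z b < ε / 2 := by
          refine hd.trans (lt_of_le_of_lt ?_ hm₃)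
          have : (m₃ : ℝ) ≤ i := by exact_mod_cast h3
          exact one_div_le_one_div_of_le (by positivity) (by linarith)
        have hbV : f b ∈ V := by
          refine hεV ⟨Metric.mem_ball.2 ?_, hb⟩
          have := dist_triangle_left b y z
          linarith
        have := hprod _ hbV _ (hm₁ i h1 (hΦH i b hb t)) _ (hm₂ (hΩ.2 h2 (hbt t)))
        rw [hF]
        simpa [mul_assoc] using this
    · have hk' := hk y hyB
      refine ((hFc (k y)).continuousAt ((hO 0).mem_nhds hy)).congr ?_
      filter_upwards [isClosed_closure.isOpen_compl.mem_nhds hk'] with z hz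
      have hzB : z ∉ B := hBout (k y + 1) z hz
      rw [if_neg hzB]
      rcases le_total (k y) (k z) with h | h
      · exact (hstable _ _ h z hz).symm
      · exact hstable _ _ h z (hk z hzB)
  · obtain ⟨i, t, hi, -, hF⟩ := hFval y hy hyB
    exact ⟨i, t, hON i hi, (if_neg hyB).trans hF⟩

/-! ### ARs and ANRs -/

theorem IsANR.of_nhds_retract {X X' : Type u} [TopologicalSpace X] [TopologicalSpace X']
    [TopologicalSpace.MetrizableSpace X'] (hX : IsANR X) (i : C(X', X)) {W : Set X}
    (hW : IsOpen W) (hiW : ∀ x, i x ∈ W) {r : X → X'} (hr : ContinuousOn r W)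
    (hri : ∀ x, r (i x) = x) : IsANR X' := by
  refine ⟨inferInstance, fun Y _ _ B hB f => ?_⟩
  obtain ⟨U, hBU, hU, F, hF⟩ := hX.2 Y B hB (i.comp f)
  obtain ⟨V, hV, hVW⟩ := isOpen_induced_iff.1 (hW.preimage F.continuous)
  have hmem : ∀ y : U, (y : Y) ∈ V ↔ F y ∈ W := fun y => by
    rw [← mem_preimage (f := F), ← hVW, mem_preimage]
  have hBV : B ⊆ V := fun b hb => (hmem ⟨b, hBU hb⟩).2 (by
    have := hF ⟨b, hb⟩
    rw [inclusion_mk] at this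
    rw [this]
    exact hiW _)
  refine ⟨U ∩ V, subset_inter hBU hBV, Filter.inter_mem hU (hV.mem_nhdsSet.2 hBV),
    ⟨fun y => r (F ⟨y, y.2.1⟩), ?_⟩, fun b => ?_⟩
  · exact hr.comp_continuous (F.continuous.comp (by fun_prop)) fun y => (hmem ⟨y, y.2.1⟩).1 y.2.2
  · have := hF b
    simp only [ContinuousMap.coe_mk]
    exact (congrArg r this).trans (hri _)

theorem IsANR.isAR_of_contractible {X : Type u} [TopologicalSpace X] [ContractibleSpace X]
    (hX : IsANR X) : IsAR X := by
  classical
  refine ⟨hX.1, fun Y _ _ B hB f => ?_⟩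
  obtain ⟨U, hBU, hU, F, hF⟩ := hX.2 Y B hB f
  obtain ⟨p, ⟨H⟩⟩ := id_nullhomotopic X
  have hBi : B ⊆ interior U := subset_interior_iff_mem_nhdsSet.2 hU
  let _ := TopologicalSpace.metrizableSpaceMetric Y
  obtain ⟨l, D, hD, hDU, hl1, hl0⟩ := exists_unitInterval_bump hB isOpen_interior hBi
  let g : Y → X := fun y => if h : y ∈ U then H (unitInterval.symm (l y), F ⟨y, h⟩) else p
  have hg : Continuous g := by
    refine continuous_iff_continuousAt.2 fun y => ?_
    by_cases hy : y ∈ interior U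
    · have h1 : ContinuousOn g U := by
        rw [continuousOn_iff_continuous_domRestrict]
        have : Continuous fun y : U => H (unitInterval.symm (l y), F y) :=
          H.continuous.comp (by fun_prop)
        refine this.congr fun y => ?_
        simp [g]
      exact h1.continuousAt (mem_interior_iff_mem_nhds.1 hy)
    · refine (continuousAt_const (y := p)).congr ?_
      filter_upwards [hD.isOpen_compl.mem_nhds fun h => hy (hDU h)] with z hz
      by_cases h : z ∈ U
      · simp only [g, dif_pos h, hl0 z hz, unitInterval.symm_zero]
        exact (H.apply_one _).symm
      · simp only [g, dif_neg h]
  refine ⟨⟨g, hg⟩, fun b => ?_⟩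
  have hb := hF b
  simp only [ContinuousMap.coe_mk, g, dif_pos (hBU b.2), hl1 b b.2, unitInterval.symm_one]
  refine (H.apply_zero _).trans ?_
  exact hb

/-- The structure group is a retract of a neighbourhood in the total space: in a trivialization `t`
near `p 1`, take `g ↦ (t 1).2⁻¹ * (t g).2`, which fixes `S` by equivariance. -/
theorem IsPrincipalBundle.exists_retraction {P : Type u} {B : Type v} [Group P]
    [TopologicalSpace P] [IsTopologicalGroup P] [TopologicalSpace B] {S : Subgroup P} {p : P → B}
    (h : IsPrincipalBundle S p) (hp : ∀ s ∈ S, p s = p 1) :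
    ∃ (W : Set P) (r : P → S), IsOpen W ∧ (∀ s ∈ S, s ∈ W) ∧ ContinuousOn r W ∧
      ∀ s : S, r s = s := by
  obtain ⟨t, hb, ht⟩ := h (p 1)
  refine ⟨t.source, fun g => (t 1).2⁻¹ * (t g).2, t.open_source, fun s hs => ?_, ?_, fun s => ?_⟩
  · rw [t.mem_source, hp s hs]
    exact hb
  · exact continuousOn_const.mul (continuous_snd.comp_continuousOn
      t.toOpenPartialHomeomorph.continuousOn)
  · have := ht 1 s hb
    rw [one_mul] at this
    simp [this]

/-! ### Groups of a transformation group and their identity components -/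

section

variable {G : Type u} {M : Type v} [Group G] [TopologicalSpace G] [IsTopologicalGroup G]
  [TopologicalSpace M] [MulAction G M]

instance Subgroup.instMetrizableSpace [TopologicalSpace.MetrizableSpace G] (H : Subgroup G) :
    TopologicalSpace.MetrizableSpace H :=
  IsEmbedding.subtypeVal.metrizableSpace

theorem identityComponent_le (H : Subgroup G) : identityComponent H ≤ H := by
  rintro _ ⟨x, -, rfl⟩
  exact x.2

theorem mem_identityComponent_of_continuous {Z : Type*} [TopologicalSpace Z]
    [PreconnectedSpace Z] {H : Subgroup G} {f : Z → G} (hf : Continuous f) (hfH : ∀ z, f z ∈ H)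
    {z₀ : Z} (h0 : f z₀ = 1) (z : Z) : f z ∈ identityComponent H := by
  let g : Z → H := fun z => ⟨f z, hfH z⟩
  have hg : Continuous g := hf.subtype_mk hfH
  have h1 : (1 : H) ∈ range g := ⟨z₀, Subtype.ext h0⟩
  exact ⟨g z, (isPreconnected_range hg).subset_connectedComponent h1 ⟨z, rfl⟩, rfl⟩

theorem le_identityComponent {H K : Subgroup G} [PreconnectedSpace H] (h : H ≤ K) :
    H ≤ identityComponent K := fun g hg =>
  mem_identityComponent_of_continuous (Z := H) (z₀ := 1) continuous_subtype_val
    (fun z => h z.2) rfl ⟨g, hg⟩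

instance preconnectedSpace_identityComponent (H : Subgroup G) :
    PreconnectedSpace (identityComponent H) := by
  have h : (identityComponent H : Set G) = Subtype.val '' connectedComponent (1 : H) := by
    ext g
    rfl
  refine isPreconnected_iff_preconnectedSpace.1 (?_ : IsPreconnected (identityComponent H : Set G))
  rw [h]
  exact isPreconnected_connectedComponent.image _ continuous_subtype_val.continuousOn

theorem mem_relSubgroup {K N : Set M} {g : G} :
    g ∈ relSubgroup G K N ↔ (∀ x ∈ K, g • x = x) ∧ ∀ x ∉ N, g • x = x := by
  simp [relSubgroup, Subgroup.mem_inf, mem_fixingSubgroup_iff]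

theorem relSubgroup_univ (K : Set M) : relSubgroup G K univ = fixingSubgroup G K := by
  ext g
  simp [mem_relSubgroup, mem_fixingSubgroup_iff]

theorem relSubgroup_empty_univ : relSubgroup G (∅ : Set M) univ = ⊤ := by
  ext g
  simp [mem_relSubgroup]

theorem relSubgroup_anti {K K' : Set M} (N : Set M) (h : K ⊆ K') :
    relSubgroup G K' N ≤ relSubgroup G K N :=
  inf_le_inf (fixingSubgroup_antitone G M h) le_rfl

namespace EmbeddingSpace

theorem continuous_resComponent (K L N : Set M) : Continuous (resComponent G K L N) :=
  ((continuous_res G K L N).comp (f := fun g : identityComponent (relSubgroup G K N) =>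
    (⟨g, identityComponent_le _ g.2⟩ : relSubgroup G K N))
    (continuous_subtype_val.subtype_mk _)).subtype_mk _

theorem resComponent_eq_iff {K L N : Set M} (g h : identityComponent (relSubgroup G K N)) :
    resComponent G K L N g = resComponent G K L N h ↔ (g : G)⁻¹ * h ∈ fixingSubgroup G L := by
  have h1 : resComponent G K L N g = resComponent G K L N h ↔
      (fun x : L => (g : G) • (x : M)) = fun x : L => (h : G) • (x : M) := by
    exact Subtype.ext_iff.trans Subtype.ext_iff
  rw [h1, mem_fixingSubgroup_iff]
  constructor
  · intro h x hx
    rw [mul_smul, ← congrFun h ⟨x, hx⟩, inv_smul_smul]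
  · intro h
    funext x
    rw [eq_comm, ← inv_smul_eq_iff, ← mul_smul]
    exact h x x.2

end EmbeddingSpace

theorem IsExhaustingSequence.monotone {Ms : ℕ → Set M} (hMs : IsExhaustingSequence Ms) :
    Monotone Ms :=
  monotone_nat_of_le_succ fun n => (hMs.subset_interior n).trans interior_subset

theorem IsExhaustingSequence.exists_subset {Ms : ℕ → Set M} (hMs : IsExhaustingSequence Ms)
    {K : Set M} (hK : IsCompact K) : ∃ n, K ⊆ Ms n := by
  obtain ⟨n, hn⟩ := hK.elim_directed_cover (fun n => interior (Ms n)) (fun n => isOpen_interior)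
    (fun x _ => by
      obtain ⟨n, hn⟩ := mem_iUnion.1 (hMs.iUnion_eq ▸ mem_univ x)
      exact mem_iUnion.2 ⟨n + 1, hMs.subset_interior n hn⟩)
    (Monotone.directed_le fun n m h => interior_mono (hMs.monotone h))
  exact ⟨n, hn.trans interior_subset⟩

theorem HasWeakTopology.exists_fixingSubgroup_subset {Ms : ℕ → Set M}
    (hMs : IsExhaustingSequence Ms) (h : HasWeakTopology G M) {W : Set G} (hW : W ∈ 𝓝 (1 : G)) :
    ∃ n, ∀ m ≥ n, (fixingSubgroup G (Ms m) : Set G) ⊆ W := by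
  obtain ⟨K, hK, hKW⟩ := h W hW
  obtain ⟨n, hn⟩ := hMs.exists_subset hK
  exact ⟨n, fun m hm => Subset.trans
    (fixingSubgroup_antitone G M (hn.trans (hMs.monotone hm))) hKW⟩

variable (G) in
/-- `G_{M_k}(U_j)₀`, where `U_j = Int M_j`. -/
abbrev relComponent (Ms : ℕ → Set M) (k j : ℕ) : Subgroup G :=
  identityComponent (relSubgroup G (Ms k) (interior (Ms j)))

variable (G) in
/-- `(G_{M_k})₀`, written as `G_{M_k}(M)₀` so that it is the source of the restriction map to
`ℰ^G_{M_k}(M_i, M)₀`. For `k = 0` it is `G₀`. -/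
abbrev fixComponent (Ms : ℕ → Set M) (k : ℕ) : Subgroup G :=
  identityComponent (relSubgroup G (Ms k) univ)

theorem relComponent_mono {Ms : ℕ → Set M} (hMs : IsExhaustingSequence Ms) (k : ℕ) :
    Monotone (relComponent G Ms k) := fun _ _ h =>
  identityComponent_mono (EmbeddingSpace.relSubgroup_mono G _ (interior_mono (hMs.monotone h)))

theorem relComponent_anti {Ms : ℕ → Set M} (hMs : IsExhaustingSequence Ms) (j : ℕ) :
    Antitone fun k => relComponent G Ms k j := fun _ _ h =>
  identityComponent_mono (relSubgroup_anti _ (hMs.monotone h))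

theorem relComponent_le_fixComponent (Ms : ℕ → Set M) (k j : ℕ) :
    relComponent G Ms k j ≤ fixComponent G Ms k :=
  identityComponent_mono (EmbeddingSpace.relSubgroup_mono G _ (subset_univ _))

theorem fixComponent_le_fixingSubgroup (Ms : ℕ → Set M) (k : ℕ) :
    fixComponent G Ms k ≤ fixingSubgroup G (Ms k) :=
  (identityComponent_le _).trans (relSubgroup_univ _).le

theorem fixComponent_zero {Ms : ℕ → Set M} (hMs : IsExhaustingSequence Ms) :
    fixComponent G Ms 0 = identityComponent ⊤ := by
  rw [fixComponent, hMs.zero, relSubgroup_empty_univ]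

theorem structureGroup_mono {Ms : ℕ → Set M} (hMs : IsExhaustingSequence Ms) (k i : ℕ) :
    Monotone (structureGroup G Ms k i) := fun _ _ h =>
  inf_le_inf (relComponent_mono hMs k h) le_rfl

/-- A connected `𝒢^i_{k,j}` is `G_{M_i}(U_j)₀`: it lies between this group and `G_{M_i}(U_j)`. -/
theorem structureGroup_eq_relComponent {Ms : ℕ → Set M} (hMs : IsExhaustingSequence Ms)
    {k i j : ℕ} (hki : k ≤ i) [PreconnectedSpace (structureGroup G Ms k i j)] :
    structureGroup G Ms k i j = relComponent G Ms i j := by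
  refine le_antisymm (le_identityComponent fun g hg => ?_) (le_inf ?_ ?_)
  · exact ⟨hg.2, (identityComponent_le _ hg.1).2⟩
  · exact relComponent_anti hMs j hki
  · exact (identityComponent_le _).trans inf_le_left

variable (G) in
/-- `⋃_j G(U_j)₀`, a subgroup contained in `G^{c*}_0`. The supremum of this increasing sequence of
subgroups is its union. -/
def compactCore (Ms : ℕ → Set M) : Subgroup G :=
  ⨆ j, relComponent G Ms 0 j

theorem relComponent_le_compactCore {Ms : ℕ → Set M} (hMs : IsExhaustingSequence Ms) (k j : ℕ) :
    relComponent G Ms k j ≤ compactCore G Ms :=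
  (relComponent_anti hMs j (Nat.zero_le k)).trans (le_iSup (relComponent G Ms 0) j)

theorem LocallyIn.mem_compactCore {Ms : ℕ → Set M} (hMs : IsExhaustingSequence Ms) {Z : Type*}
    [TopologicalSpace Z] {k : ℕ} {f : Z → G} (hf : LocallyIn (relComponent G Ms k) f) (z : Z) :
    f z ∈ compactCore G Ms := by
  obtain ⟨n, hn⟩ := hf z
  exact relComponent_le_compactCore hMs k n hn.self_of_nhds

theorem compactCore_subset [T2Space M] {Ms : ℕ → Set M} (hMs : IsExhaustingSequence Ms) :
    (compactCore G Ms : Set G) ⊆ compactIdentitySet G M := by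
  intro g hg
  obtain ⟨j, hj⟩ := (Subgroup.mem_iSup_of_directed (relComponent_mono hMs 0).directed_le).1 hg
  refine ⟨(hMs.isCompact j).of_isClosed_subset isClosed_closure
    (closure_minimal (fun x hx => ?_) (hMs.isCompact j).isClosed), Ms j, hMs.isCompact j, ?_⟩
  · by_contra h
    exact hx ((mem_relSubgroup.1 (identityComponent_le _ hj)).2 x fun hi => h (interior_subset hi))
  · rw [← hMs.zero]
    exact identityComponent_mono (EmbeddingSpace.relSubgroup_mono G _ interior_subset) hj

theorem LocallyIn.mul {Z : Type*} [TopologicalSpace Z] {A : ℕ → Subgroup G} (hA : Monotone A)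
    {f g : Z → G} (hf : LocallyIn A f) (hg : LocallyIn A g) :
    LocallyIn A fun z => f z * g z := by
  intro z
  obtain ⟨n, hn⟩ := hf z
  obtain ⟨m, hm⟩ := hg z
  refine ⟨max n m, ?_⟩
  filter_upwards [hn, hm] with y h1 h2
  exact (A _).mul_mem (hA (le_max_left n m) h1) (hA (le_max_right n m) h2)

theorem LocallyIn.inv {Z : Type*} [TopologicalSpace Z] {A : ℕ → Subgroup G}
    {f : Z → G} (hf : LocallyIn A f) : LocallyIn A fun z => (f z)⁻¹ := fun z =>
  (hf z).imp fun n hn => hn.mono fun _ h => (A n).inv_mem h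

theorem LocallyIn.shift {Z : Type*} [TopologicalSpace Z] {A : ℕ → Subgroup G} (hA : Monotone A)
    {f : Z → G} (hf : LocallyIn A f) (m : ℕ) : LocallyIn (fun n => A (m + n)) f := fun z =>
  (hf z).imp fun n hn => hn.mono fun _ h => hA (Nat.le_add_left n m) h

theorem LocallyIn.of_shift {Z : Type*} [TopologicalSpace Z] {A : ℕ → Subgroup G}
    {f : Z → G} {m : ℕ} (hf : LocallyIn (fun n => A (m + n)) f) : LocallyIn A f := fun z =>
  (hf z).elim fun n hn => ⟨m + n, hn⟩

end

/-! ### Sections of the restriction maps -/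

section Sections

variable {G : Type u} {M : Type v} [Group G] [TopologicalSpace G] [IsTopologicalGroup G]
  [TopologicalSpace M] [MulAction G M] {Ms : ℕ → Set M}

namespace BundleANRAssumption

theorem range_inclComponent_mono (hMs : IsExhaustingSequence Ms) {k i j j' : ℕ} (h : j ≤ j') :
    range (EmbeddingSpace.inclComponent G (Ms k) (Ms i) (subset_univ (interior (Ms j)))) ⊆
      range (EmbeddingSpace.inclComponent G (Ms k) (Ms i) (subset_univ (interior (Ms j')))) := by
  rintro _ ⟨f, rfl⟩
  exact ⟨EmbeddingSpace.inclComponent G (Ms k) (Ms i) (interior_mono (hMs.monotone h)) f, rfl⟩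

/-- Near a point of `𝒰^i_{k,j}` the restriction map has a section with values in `G_{M_k}(U_j)₀`. -/
theorem exists_local_section (hA : BundleANRAssumption G Ms) {k i j : ℕ} (hki : k < i)
    (hij : i < j) {w : EmbeddingSpace.component G (Ms k) (Ms i) univ}
    (hw : w ∈ range
      (EmbeddingSpace.inclComponent G (Ms k) (Ms i) (subset_univ (interior (Ms j))))) :
    ∃ W ∈ 𝓝 w, ∃ s : EmbeddingSpace.component G (Ms k) (Ms i) univ → relComponent G Ms k j,
      ContinuousOn s W ∧ ∀ y ∈ W, EmbeddingSpace.resComponent G (Ms k) (Ms i) univ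
        ⟨s y, relComponent_le_fixComponent Ms k j (s y).2⟩ = y := by
  obtain ⟨b, rfl⟩ := hw
  obtain ⟨t, hb, -⟩ := hA.bundle k i j hki hij b
  have hι := hA.isOpenEmbedding k i j hki hij
  have : Nonempty (EmbeddingSpace.component G (Ms k) (Ms i) (interior (Ms j))) := ⟨b⟩
  set ι := EmbeddingSpace.inclComponent G (Ms k) (Ms i) (subset_univ (interior (Ms j)))
  let e := hι.toOpenPartialHomeomorph ι
  have he : ∀ x, e.symm (ι x) = x := fun x => hι.toOpenPartialHomeomorph_left_inv ι
  refine ⟨ι '' t.baseSet, (hι.isOpenMap _ t.open_baseSet).mem_nhds ⟨b, hb, rfl⟩,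
    fun y => t.toOpenPartialHomeomorph.symm (e.symm y, 1), ?_, ?_⟩
  · refine t.toOpenPartialHomeomorph.continuousOn_symm.comp
      (f := fun y => (e.symm y, (1 : (structureGroup G Ms k i j).subgroupOf _))) ?_ ?_
    · refine ContinuousOn.prodMk (e.continuousOn_symm.mono ?_) continuousOn_const
      rintro _ ⟨x, -, rfl⟩
      exact hι.toOpenPartialHomeomorph_target ι ▸ mem_range_self x
    · rintro _ ⟨x, hx, rfl⟩
      rw [t.mem_target]
      dsimp only
      rw [he]
      exact hx
  · rintro _ ⟨x, hx, rfl⟩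
    have h1 := t.proj_symm_apply' (x := 1) hx
    simp only [he]
    exact Eq.trans rfl (congrArg ι h1)

/-- If the `𝒢^i_{k,j}` are contractible, the elements of `(G_{M_k})₀` are approximated continuously, by
elements with the same restriction to `M_i`, in `⋃_j G_{M_k}(U_j)₀`. -/
theorem exists_leveled_section (hMs : IsExhaustingSequence Ms) (hA : BundleANRAssumption G Ms)
    {k i : ℕ} (hki : k < i)
    (hS : ∀ j, i < j → ContractibleSpace (structureGroup G Ms k i j)) :
    ∃ σ : fixComponent G Ms k → G, Continuous σ ∧ LocallyIn (relComponent G Ms k) σ ∧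
      ∀ z : fixComponent G Ms k, (z : G)⁻¹ * σ z ∈ fixingSubgroup G (Ms i) := by
  classical
  have hGm := hA.metrizable
  let ρ := EmbeddingSpace.resComponent G (Ms k) (Ms i) univ
  have hρ : Continuous ρ := EmbeddingSpace.continuous_resComponent _ _ _
  have hlt : ∀ n, i < i + 1 + n := fun n => by omega
  have : ∀ n, ContractibleSpace (structureGroup G Ms k i (i + 1 + n)) := fun n => hS _ (hlt n)
  let T : ℕ → Set (EmbeddingSpace.component G (Ms k) (Ms i) univ) := fun n => range
    (EmbeddingSpace.inclComponent G (Ms k) (Ms i) (subset_univ (interior (Ms (i + 1 + n)))))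
  let O : ℕ → Set (fixComponent G Ms k) := fun n => ρ ⁻¹' T n
  have hO : ∀ n, IsOpen (O n) := fun n =>
    (hA.isOpenEmbedding k i _ hki (hlt n)).isOpen_range.preimage hρ
  have hloc : ∀ n, ∀ z ∈ O n, ∃ W ∈ 𝓝 z, ∃ τ : fixComponent G Ms k → G, ContinuousOn τ W ∧
      ∀ y ∈ W, τ y ∈ relComponent G Ms k (i + 1 + n) ∧
        (y : G)⁻¹ * τ y ∈ fixingSubgroup G (Ms i) := by
    intro n z hz
    obtain ⟨W, hW, s, hs, hsW⟩ := hA.exists_local_section hki (hlt n) hz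
    refine ⟨ρ ⁻¹' W, hρ.continuousAt hW, fun z => s (ρ z), continuous_subtype_val.comp_continuousOn
      (hs.comp hρ.continuousOn fun y hy => hy), fun y hy => ⟨(s (ρ y)).2, ?_⟩⟩
    exact (EmbeddingSpace.resComponent_eq_iff y ⟨s (ρ y), _⟩).1 (hsW _ hy).symm
  -- over the preimage of a single `𝒰^i_{k,j}` the structure group is `𝒢^i_{k,j}`
  have hτ : ∀ n, ∃ τ : O n → G, Continuous τ ∧ ∀ z, τ z ∈ relComponent G Ms k (i + 1 + n) ∧
        (z.1 : G)⁻¹ * τ z ∈ fixingSubgroup G (Ms i) := by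
    intro n
    have hc : ∀ z : O n, ∃ g ∈ relComponent G Ms k (i + 1 + n),
        (z.1 : G)⁻¹ * g ∈ fixingSubgroup G (Ms i) := fun z => by
      obtain ⟨W, hW, τ, -, hτ⟩ := hloc n z z.2
      exact ⟨τ z, hτ z (mem_of_mem_nhds hW)⟩
    choose c hcP hcf using hc
    have hcS : ∀ (z : O n) (g : G), (c z)⁻¹ * g ∈ structureGroup G Ms k i (i + 1 + n) ↔
        g ∈ relComponent G Ms k (i + 1 + n) ∧ (z.1 : G)⁻¹ * g ∈ fixingSubgroup G (Ms i) := by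
      intro z g
      rw [structureGroup, Subgroup.mem_inf,
        Subgroup.mul_mem_cancel_left _ (Subgroup.inv_mem _ (hcP z)),
        ← Subgroup.mul_mem_cancel_left (fixingSubgroup G (Ms i)) (hcf z)]
      simp [mul_assoc]
    obtain ⟨τ, hτ, hτc⟩ := exists_continuous_lift (structureGroup G Ms k i (i + 1 + n)) c
      fun z => by
        obtain ⟨W, hW, τ, hτ, hτW⟩ := hloc n z z.2
        exact ⟨Subtype.val ⁻¹' W, continuous_subtype_val.continuousAt hW, fun y => τ y,
          hτ.comp continuous_subtype_val.continuousOn fun y hy => hy,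
          fun y hy => (hcS y _).2 (hτW y hy)⟩
    exact ⟨τ, hτ, fun z => (hcS z _).1 (hτc z)⟩
  choose τ hτ hτP using hτ
  have hτ' : ∀ n z (h : z ∈ O n), (if h : z ∈ O n then τ n ⟨z, h⟩ else 1) = τ n ⟨z, h⟩ :=
    fun n z h => dif_pos h
  obtain ⟨σ, hσ, hσS, -⟩ := exists_leveled_lift
    (S := fun n => structureGroup G Ms k i (i + 1 + n))
    (fun n m h => structureGroup_mono hMs k i (Nat.add_le_add_left h _)) hO
    (fun n m h => preimage_mono (range_inclComponent_mono hMs (Nat.add_le_add_left h _)))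
    (by
      rw [eq_univ_iff_forall]
      intro z
      obtain ⟨j, hj, hz⟩ := mem_iUnion₂.1
        ((hA.iUnion_range k i hki).symm ▸ mem_univ (ρ z))
      refine mem_iUnion.2 ⟨j, range_inclComponent_mono hMs ?_ hz⟩
      omega)
    (fun n z => if h : z ∈ O n then τ n ⟨z, h⟩ else 1)
    (fun n => by
      rw [continuousOn_iff_continuous_domRestrict]
      refine (hτ n).congr fun z => ?_
      exact (hτ' n z z.2).symm)
    (fun n z hz => by
      have hz' : z ∈ O (n + 1) :=
        range_inclComponent_mono hMs (Nat.add_le_add_left (Nat.le_succ n) _) hz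
      rw [hτ' n z hz, hτ' (n + 1) z hz']
      obtain ⟨h1, h2⟩ := hτP n ⟨z, hz⟩
      obtain ⟨h3, h4⟩ := hτP (n + 1) ⟨z, hz'⟩
      refine ⟨Subgroup.mul_mem _ (Subgroup.inv_mem _ h3)
        (relComponent_mono hMs k (Nat.add_le_add_left (Nat.le_succ n) _) h1), ?_⟩
      have := Subgroup.mul_mem _ (Subgroup.inv_mem _ h4) h2
      simpa [mul_assoc] using this)
  have key : ∀ n y, y ∈ O n → (if h : y ∈ O n then τ n ⟨y, h⟩ else 1)⁻¹ * σ y ∈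
      structureGroup G Ms k i (i + 1 + n) →
      σ y ∈ relComponent G Ms k (i + 1 + n) ∧ (y : G)⁻¹ * σ y ∈ fixingSubgroup G (Ms i) := by
    intro n y hy h
    rw [hτ' n y hy] at h
    obtain ⟨h1, h2⟩ := hτP n ⟨y, hy⟩
    refine ⟨(Subgroup.mul_mem_cancel_left _ (Subgroup.inv_mem _ h1)).1 h.1, ?_⟩
    have := Subgroup.mul_mem _ h2 h.2
    simpa [mul_assoc] using this
  refine ⟨σ, hσ, fun z => ?_, fun z => ?_⟩
  · obtain ⟨n, hn⟩ := hσS z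
    exact ⟨i + 1 + n, hn.mono fun y hy => (key n y hy.1 hy.2).1⟩
  · obtain ⟨n, hn⟩ := hσS z
    exact (key n z hn.self_of_nhds.1 hn.self_of_nhds.2).2

end BundleANRAssumption

end Sections

/-! ### Infinite products: the case of contractible groups `G_{M_k}(U_i)₀` -/

section Product

variable {G : Type u} {M : Type v} [Group G] [TopologicalSpace G] [IsTopologicalGroup G]
  [TopologicalSpace M] [MulAction G M] {Ms : ℕ → Set M}

theorem compactCore_le_fixComponent (Ms : ℕ → Set M) :
    compactCore G Ms ≤ fixComponent G Ms 0 :=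
  iSup_le fun j => relComponent_le_fixComponent Ms 0 j

namespace BundleANRAssumption

theorem isAR_relComponent (hMs : IsExhaustingSequence Ms) (hA : BundleANRAssumption G Ms)
    (hcontr : ∀ k i, k < i → ContractibleSpace (relComponent G Ms k i))
    (hconn : ∀ k i j, k < i → i < j → ConnectedSpace (structureGroup G Ms k i j))
    {i j : ℕ} (hij : i < j) : IsAR (relComponent G Ms i j) := by
  have hGm := hA.metrizable
  have := hcontr i j hij
  have h0 : IsANR (relComponent G Ms 0 j) := by
    rw [relComponent, hMs.zero]
    exact hA.anr j (by omega)
  refine IsANR.isAR_of_contractible ?_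
  rcases Nat.eq_zero_or_pos i with rfl | hi
  · exact h0
  have := hconn 0 i j hi hij
  rw [← structureGroup_eq_relComponent hMs (Nat.zero_le i)]
  obtain ⟨W, r, hW, hSW, hr, hrs⟩ := (hA.bundle 0 i j hi hij).exists_retraction fun s hs => by
    rw [EmbeddingSpace.resComponent_eq_iff]
    simpa using (hs : (s : G) ∈ structureGroup G Ms 0 i j).2
  refine h0.of_nhds_retract ⟨fun g => ⟨g, g.2.1⟩, by fun_prop⟩ hW
    (fun g => hSW _ g.2) (r := fun g => ⟨r g, (r g).2⟩) ?_ fun g => ?_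
  · rw [IsInducing.subtypeVal.continuousOn_iff]
    exact (continuous_subtype_val.comp continuous_subtype_val).comp_continuousOn hr
  · have := hrs ⟨⟨g, g.2.1⟩, g.2⟩
    exact Subtype.ext (congrArg (fun s => ((s : relComponent G Ms 0 j) : G))
      (congrArg Subtype.val this))

/-- A normalized section gives a continuous factorization `h = σ(h) θ(h)` with `σ(h)` in
`⋃_j G_{M_k}(U_j)₀` and `θ(h)` in `(G_{M_i})₀`. -/
theorem exists_factorization (hMs : IsExhaustingSequence Ms) (hA : BundleANRAssumption G Ms)
    {k i : ℕ} (hki : k < i) (hS : ∀ j, i < j → ContractibleSpace (structureGroup G Ms k i j)) :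
    ∃ (σ : fixComponent G Ms k → G) (θ : C(fixComponent G Ms k, fixComponent G Ms i)),
      Continuous σ ∧ LocallyIn (relComponent G Ms k) σ ∧
        ∀ z : fixComponent G Ms k, (z : G) = σ z * θ z := by
  obtain ⟨σ, hσ, hσP, hσf⟩ := hA.exists_leveled_section hMs hki hS
  have h1 : σ 1 ∈ fixingSubgroup G (Ms i) := by simpa using hσf 1
  have hc : LocallyIn (relComponent G Ms k) fun _ : fixComponent G Ms k => (σ 1)⁻¹ := fun _ =>
    (hσP 1).imp fun n hn => Filter.Eventually.of_forall fun _ =>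
      Subgroup.inv_mem _ hn.self_of_nhds
  -- the remainder is in the identity component, since it is `1` at `1` and its source is connected
  have hmem : ∀ z : fixComponent G Ms k, (σ z * (σ 1)⁻¹)⁻¹ * z ∈ fixComponent G Ms i := by
    refine mem_identityComponent_of_continuous (z₀ := 1) (by fun_prop) (fun z => ?_) (by simp)
    rw [relSubgroup_univ]
    have := Subgroup.mul_mem _ h1 (Subgroup.inv_mem _ (hσf z))
    simpa [mul_assoc] using this
  exact ⟨fun z => σ z * (σ 1)⁻¹, ⟨fun z => ⟨_, hmem z⟩, by fun_prop⟩, by fun_prop,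
    hσP.mul (relComponent_mono hMs k) hc, fun z => by simp [mul_assoc]⟩

/-- Maps from closed subsets of metrizable spaces to `G₀` extend, with values in `⋃_j G(U_j)₀` off the
closed set. This contains both the AR property and homotopy density. -/
theorem exists_extension (hMs : IsExhaustingSequence Ms) (hA : BundleANRAssumption G Ms)
    (hcontr : ∀ k i, k < i → ContractibleSpace (relComponent G Ms k i))
    (hconn : ∀ k i j, k < i → i < j → ConnectedSpace (structureGroup G Ms k i j))
    {Y : Type u} [TopologicalSpace Y] [TopologicalSpace.MetrizableSpace Y] {B : Set Y}
    (hB : IsClosed B) (f : C(B, fixComponent G Ms 0)) :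
    ∃ F : C(Y, fixComponent G Ms 0), (∀ b : B, F b = f b) ∧
      ∀ y ∉ B, (F y : G) ∈ compactCore G Ms := by
  classical
  have hGm := hA.metrizable
  have hS : ∀ k i j, k < i → i < j → ContractibleSpace (structureGroup G Ms k i j) := by
    intro k i j hki hij
    have := hconn k i j hki hij
    rw [structureGroup_eq_relComponent hMs hki.le]
    exact hcontr i j hij
  choose σ θ hσ hσP hσθ using fun i => hA.exists_factorization hMs (Nat.lt_succ_self i)
    fun j hj => hS i (i + 1) j (Nat.lt_succ_self i) hj
  -- the remainder of `h` after splitting off its first `i` factors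
  let rem : ∀ i, C(fixComponent G Ms 0, fixComponent G Ms i) := fun i =>
    Nat.rec (ContinuousMap.id _) (fun i c => (θ i).comp c) i
  have hrem : ∀ i h, (rem i h : G) = σ i (rem i h) * rem (i + 1) h := fun i h => hσθ i (rem i h)
  -- the levels start at `j = i + 1`, as `G_{M_i}(U_j)₀` is assumed contractible only for `j > i`
  let A : ℕ → ℕ → Subgroup G := fun i n => relComponent G Ms i (i + 1 + n)
  have hAmono : ∀ i, Monotone (A i) := fun i n m h =>
    relComponent_mono hMs i (Nat.add_le_add_left h _)
  have hAcontr : ∀ i n, ContractibleSpace (A i n) := fun i n => hcontr i _ (by omega)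
  -- `F i` extends the `i`-th factor of `f`
  have hF : ∀ i, ∃ F : Y → G, Continuous F ∧ LocallyIn (A i) F ∧
      ∀ b : B, F b = σ i (rem i (f b)) := by
    intro i
    have hg : Continuous fun b : B => σ i (rem i (f b)) := by
      have := hσ i
      fun_prop
    let g : Y → G := fun y => if h : y ∈ B then σ i (rem i (f ⟨y, h⟩)) else 1
    have hgb : ∀ b : B, g b = σ i (rem i (f b)) := fun b => dif_pos b.2
    obtain ⟨F, hF, hFA, hFg⟩ := exists_leveled_extension (hAmono i)
      (fun n => hA.isAR_relComponent hMs hcontr hconn (by omega)) hB (f := g)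
      (continuousOn_iff_continuous_domRestrict.2 (hg.congr fun b => (hgb b).symm)) (by
        intro b hb
        obtain ⟨n, hn⟩ := ((hσP i).shift (relComponent_mono hMs i) (i + 1)) (rem i (f ⟨b, hb⟩))
        refine ⟨n, ?_⟩
        rw [nhdsWithin_eq_map_subtype_coe hb, Filter.eventually_map]
        have hc : Continuous fun b : B => rem i (f b) := by fun_prop
        filter_upwards [hc.continuousAt.eventually hn] with y hy
        rw [hgb y]
        exact hy)
    exact ⟨F, hF, hFA, fun b => (hFg b b.2).trans (hgb b)⟩
  choose F hFc hFA hFb using hF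
  choose C hCc hCA hC0 hC1 using fun i => exists_leveled_homotopy (hAmono i) (hFc i) (hFA i)
  have hCA' : ∀ i, LocallyIn (relComponent G Ms i) (C i) := fun i => (hCA i).of_shift
  -- the partial products `F 0 * ⋯ * F (i - 1)`
  let q : ℕ → Y → G := fun i => Nat.rec (fun _ => 1) (fun i p y => p y * F i y) i
  have hq0 : ∀ y, q 0 y = 1 := fun y => rfl
  have hqs : ∀ i y, q (i + 1) y = q i y * F i y := fun i y => rfl
  have hqc : ∀ i, Continuous (q i) := by
    intro i
    induction i with
    | zero => exact continuous_const
    | succ i ih => exact ih.mul (hFc i)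
  have hqcore : ∀ i y, q i y ∈ compactCore G Ms := by
    intro i y
    induction i with
    | zero => exact Subgroup.one_mem _
    | succ i ih =>
      exact Subgroup.mul_mem _ ih (LocallyIn.mem_compactCore hMs (hFA i).of_shift y)
  have hqb : ∀ i (b : B), (f b : G) = q i b * rem i (f b) := by
    intro i b
    induction i with
    | zero => simp [hq0, rem]
    | succ i ih => rw [hqs, hFb, mul_assoc, ← hrem, ih]
  let f' : Y → G := fun y => if h : y ∈ B then f ⟨y, h⟩ else 1
  have hf' : ∀ b : B, f' b = f b := fun b => dif_pos b.2
  obtain ⟨E, hE, hEb, hEy⟩ := exists_telescope hB (f := f')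
    (continuousOn_iff_continuous_domRestrict.2
      ((continuous_subtype_val.comp f.continuous).congr fun b => (hf' b).symm))
    (H := fun i => fixingSubgroup G (Ms i))
    (fun W hW => hA.weak.exists_fixingSubgroup_subset hMs hW) (N := fun _ => univ)
    (fun _ => isOpen_univ) (fun _ => subset_univ _)
    (Φ := fun i p => q i p.1 * C i p)
    (fun i => (((hqc i).comp continuous_fst).mul (hCc i)).continuousOn)
    (fun i y _ => by simp only [hC0, hC1, hqs, mul_one])
    (fun i b hb t => by
      rw [hf' ⟨b, hb⟩, hqb i ⟨b, hb⟩, mul_inv_rev, mul_assoc, inv_mul_cancel_left]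
      obtain ⟨n, hn⟩ := hCA' i (b, t)
      exact Subgroup.mul_mem _ (Subgroup.inv_mem _ (fixComponent_le_fixingSubgroup Ms i
        (rem i _).2)) (fixComponent_le_fixingSubgroup Ms i
        (relComponent_le_fixComponent Ms i n hn.self_of_nhds)))
  have hEcore : ∀ y ∉ B, E y ∈ compactCore G Ms := by
    intro y hy
    obtain ⟨i, t, -, h⟩ := hEy y (mem_univ y) hy
    rw [h]
    exact Subgroup.mul_mem _ (hqcore i y) (LocallyIn.mem_compactCore hMs (hCA' i) _)
  have hEmem : ∀ y, E y ∈ fixComponent G Ms 0 := by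
    intro y
    by_cases hy : y ∈ B
    · rw [hEb y hy, hf' ⟨y, hy⟩]
      exact (f _).2
    · exact compactCore_le_fixComponent Ms (hEcore y hy)
  exact ⟨⟨fun y => ⟨E y, hEmem y⟩, (continuousOn_univ.1 hE).subtype_mk _⟩,
    fun b => Subtype.ext ((hEb b b.2).trans (hf' b)), hEcore⟩

theorem isAR_and_isHomotopyDense [T2Space M] (hMs : IsExhaustingSequence Ms)
    (hA : BundleANRAssumption G Ms)
    (hcontr : ∀ k i, k < i → ContractibleSpace (relComponent G Ms k i))
    (hconn : ∀ k i j, k < i → i < j → ConnectedSpace (structureGroup G Ms k i j)) :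
    IsAR (fixComponent G Ms 0) ∧
      IsHomotopyDense ((↑) ⁻¹' compactIdentitySet G M : Set (fixComponent G Ms 0)) := by
  have hGm := hA.metrizable
  refine ⟨⟨inferInstance, fun Y _ _ B hB f => ?_⟩, ?_⟩
  · obtain ⟨F, hF, -⟩ := hA.exists_extension hMs hcontr hconn hB f
    exact ⟨F, hF⟩
  · let B : Set (fixComponent G Ms 0 × unitInterval) := {p | p.2 = 0}
    have hB : IsClosed B := isClosed_eq continuous_snd continuous_const
    obtain ⟨F, hF, hFc⟩ := hA.exists_extension hMs hcontr hconn hB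
      ⟨fun p => p.1.1, by fun_prop⟩
    exact ⟨F, fun x => hF ⟨(x, 0), rfl⟩, fun x t ht => compactCore_subset hMs
      (hFc (x, t) fun h => ht.ne' h)⟩

end BundleANRAssumption

end Product

/-! ### Contractible stabilizers: the ANR property -/

theorem IsANR.exists_extension {X : Type u} [TopologicalSpace X] [Nonempty X] (hX : IsANR X)
    {Y : Type u} [TopologicalSpace Y] [TopologicalSpace.MetrizableSpace Y] {D : Set Y}
    (hD : IsClosed D) {f : Y → X} (hf : ContinuousOn f D) :
    ∃ (U : Set Y) (F : Y → X), IsOpen U ∧ D ⊆ U ∧ ContinuousOn F U ∧ ∀ y ∈ D, F y = f y := by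
  classical
  obtain ⟨U, hDU, hU, F, hF⟩ := hX.2 Y D hD
    ⟨D.domRestrict f, continuousOn_iff_continuous_domRestrict.1 hf⟩
  let F' : Y → X := fun y => if h : y ∈ U then F ⟨y, h⟩ else Classical.arbitrary X
  have hF' : ∀ y : U, F' y = F y := fun y => dif_pos y.2
  refine ⟨interior U, F', isOpen_interior, subset_interior_iff_mem_nhdsSet.2 hU, ?_,
    fun y hy => (hF' ⟨y, hDU hy⟩).trans (hF ⟨y, hy⟩)⟩
  refine ContinuousOn.mono (continuousOn_iff_continuous_domRestrict.2 ?_) interior_subset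
  exact F.continuous.congr fun y => (hF' y).symm

/-- The exponential law for functions continuous on a subset of the parameter space. -/
theorem exists_continuousMap_of_continuousOn {Z T X : Type*} [TopologicalSpace Z]
    [TopologicalSpace T] [TopologicalSpace X] [Nonempty X] {O : Set Z} {m : Z × T → X}
    (hm : ContinuousOn m (O ×ˢ univ)) :
    ∃ F : Z → C(T, X), ContinuousOn F O ∧ ∀ z ∈ O, ∀ t, F z t = m (z, t) := by
  classical
  have hz : ∀ z ∈ O, Continuous fun t => m (z, t) := fun z hz =>
    hm.comp_continuous (by fun_prop) fun t => ⟨hz, mem_univ t⟩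
  let F : Z → C(T, X) := fun z => if h : z ∈ O then ⟨_, hz z h⟩ else .const T (Classical.arbitrary X)
  have hF : ∀ z ∈ O, ∀ t, F z t = m (z, t) := fun z h t => by simp [F, h]
  refine ⟨F, continuousOn_iff_continuous_domRestrict.2 ?_, hF⟩
  refine ContinuousMap.continuous_of_continuous_uncurry _ ?_
  have : Continuous fun p : O × T => m (p.1, p.2) :=
    hm.comp_continuous (by fun_prop) fun p => ⟨p.1.2, mem_univ _⟩
  exact this.congr fun p => (hF p.1 p.1.2 p.2).symm

section

variable {G : Type u} {M : Type v} [Group G] [TopologicalSpace G] [IsTopologicalGroup G]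
  [TopologicalSpace M] [MulAction G M] {Ms : ℕ → Set M}

theorem fixingSubgroup_le_fixComponent_zero (hMs : IsExhaustingSequence Ms) (i : ℕ)
    [PreconnectedSpace (fixingSubgroup G (Ms i))] :
    fixingSubgroup G (Ms i) ≤ fixComponent G Ms 0 := by
  rw [fixComponent_zero hMs]
  exact le_identityComponent le_top

namespace BundleANRAssumption

theorem exists_mem_range (hA : BundleANRAssumption G Ms) {k i : ℕ} (hki : k < i)
    (w : EmbeddingSpace.component G (Ms k) (Ms i) univ) : ∃ j, i < j ∧ w ∈ range
      (EmbeddingSpace.inclComponent G (Ms k) (Ms i) (subset_univ (interior (Ms j)))) := by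
  obtain ⟨j, hj, hw⟩ := mem_iUnion₂.1 ((hA.iUnion_range k i hki).symm ▸ mem_univ w)
  exact ⟨j, hj, hw⟩

/-- `ℰ_∅(M_i, M)₀` is an absolute neighbourhood extensor for metrizable spaces. Locally it is a retract of
an open subset of the ANR `G(U_j)₀`, and Hanner's argument patches the local extensions. -/
theorem exists_extension_near (hMs : IsExhaustingSequence Ms) (hA : BundleANRAssumption G Ms)
    {i : ℕ} (hi : 0 < i) {Y : Type u} [TopologicalSpace Y] [TopologicalSpace.MetrizableSpace Y]
    {D : Set Y} (hD : IsClosed D) {f : Y → EmbeddingSpace.component G (Ms 0) (Ms i) univ}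
    (hf : ContinuousOn f D) :
    ∃ (U : Set Y) (F : Y → EmbeddingSpace.component G (Ms 0) (Ms i) univ), IsOpen U ∧ D ⊆ U ∧
      ContinuousOn F U ∧ ∀ y ∈ D, F y = f y := by
  classical
  let _ := TopologicalSpace.metrizableSpaceMetric Y
  have : Nonempty (EmbeddingSpace.component G (Ms 0) (Ms i) univ) :=
    ⟨EmbeddingSpace.resComponent G (Ms 0) (Ms i) univ 1⟩
  obtain ⟨U, F, hU, hDU, hF, hFf⟩ := exists_section_near hD (R := fun y x => y ∈ D → x = f y) (by
    intro b hb
    obtain ⟨j, hij, hj⟩ := hA.exists_mem_range hi (f b)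
    obtain ⟨W, hW, s, hs, hsW⟩ := hA.exists_local_section hi hij hj
    have hANR : IsANR (relComponent G Ms 0 j) := by
      rw [relComponent, hMs.zero]
      exact hA.anr j (by omega)
    obtain ⟨O, hO, hbO, hOW⟩ := mem_nhdsWithin.1 (hf b hb (interior_mem_nhds.2 hW))
    refine ⟨O, hO, hbO, fun N F hN hF hFf K hKN hK C hCO hC => ?_⟩
    have hE : IsClosed (K ∩ F ⁻¹' (interior W)ᶜ) :=
      (hF.mono hKN).preimage_isClosed_of_isClosed hK isOpen_interior.isClosed_compl
    -- on `closure V` both `f` on `D` and `F` on `K` take values in `W`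
    obtain ⟨V, hV, hCV, hVO⟩ := normal_exists_closure_subset (hD.inter hC) (hO.sdiff hE)
      (fun y hy => ⟨hCO hy.2, fun h => h.2 (by
        rw [hFf y (hKN h.1) hy.1]
        exact hOW ⟨hCO hy.2, hy.1⟩)⟩)
    let g : Y → EmbeddingSpace.component G (Ms 0) (Ms i) univ := fun y =>
      if y ∈ D then f y else F y
    have hgf : EqOn g f (D ∩ closure V) := fun y hy => if_pos hy.1
    have hgF : EqOn g F (K ∩ closure V) := fun y hy => by
      by_cases h : y ∈ D
      · exact (if_pos h).trans (hFf y (hKN hy.1) h).symm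
      · exact if_neg h
    have hg : ContinuousOn g (D ∩ closure V ∪ K ∩ closure V) :=
      ((hf.mono inter_subset_left).congr hgf).union_of_isClosed
        ((hF.mono (inter_subset_left.trans hKN)).congr hgF) (hD.inter isClosed_closure)
        (hK.inter isClosed_closure)
    have hgW : ∀ y ∈ D ∩ closure V ∪ K ∩ closure V, g y ∈ W := by
      rintro y (hy | hy)
      · rw [hgf hy]
        exact interior_subset (hOW ⟨(hVO hy.2).1, hy.1⟩)
      · rw [hgF hy]
        by_contra h
        exact (hVO hy.2).2 ⟨hy.1, fun h' => h (interior_subset h')⟩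
    obtain ⟨U, F', hU, hDU, hF', hF'g⟩ := hANR.exists_extension
      ((hD.inter isClosed_closure).union (hK.inter (isClosed_closure (s := V))))
      (hs.comp hg hgW)
    have hval : ∀ y ∈ D ∩ closure V ∪ K ∩ closure V, EmbeddingSpace.resComponent G (Ms 0) (Ms i)
        univ ⟨F' y, relComponent_le_fixComponent Ms 0 j (F' y).2⟩ = g y := by
      intro y hy
      simp only [hF'g y hy, Function.comp_apply]
      exact hsW _ (hgW y hy)
    refine ⟨U ∩ V, fun y => EmbeddingSpace.resComponent G (Ms 0) (Ms i) univ
      ⟨F' y, relComponent_le_fixComponent Ms 0 j (F' y).2⟩, hU.inter hV, fun y hy =>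
      ⟨hDU (Or.inl ⟨hy.1, subset_closure (hCV hy)⟩), hCV hy⟩, ?_, ?_, ?_⟩
    · refine (EmbeddingSpace.continuous_resComponent _ _ _).comp_continuousOn ?_
      rw [IsInducing.subtypeVal.continuousOn_iff]
      have h : ContinuousOn (fun y => (F' y : G)) (U ∩ V) :=
        continuous_subtype_val.comp_continuousOn (hF'.mono inter_subset_left)
      exact h
    · intro y hy hyD
      have hy' : y ∈ D ∩ closure V := ⟨hyD, subset_closure hy.2⟩
      exact (hval y (Or.inl hy')).trans (hgf hy')
    · intro y hy
      have hy' : y ∈ K ∩ closure V := ⟨hy.1, subset_closure hy.2.2⟩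
      exact (hval y (Or.inr hy')).trans (hgF hy'))
  exact ⟨U, F, hU, hDU, hF, fun y hy => hFf y (hDU hy) hy⟩

/-- Maps to `ℰ_∅(M_i, M)₀` lift to `G₀` if `G_{M_i}` is contractible. -/
theorem exists_lift (hMs : IsExhaustingSequence Ms) (hA : BundleANRAssumption G Ms)
    {i : ℕ} (hi : 0 < i) [ContractibleSpace (fixingSubgroup G (Ms i))]
    {Y : Type*} [TopologicalSpace Y] [TopologicalSpace.MetrizableSpace Y] {U : Set Y}
    {φ : Y → EmbeddingSpace.component G (Ms 0) (Ms i) univ} (hφ : ContinuousOn φ U) :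
    ∃ ℓ : Y → fixComponent G Ms 0, ContinuousOn ℓ U ∧
      ∀ y ∈ U, EmbeddingSpace.resComponent G (Ms 0) (Ms i) univ (ℓ y) = φ y := by
  classical
  have hloc : ∀ w : EmbeddingSpace.component G (Ms 0) (Ms i) univ, ∃ W ∈ 𝓝 w,
      ∃ s : EmbeddingSpace.component G (Ms 0) (Ms i) univ → fixComponent G Ms 0,
        ContinuousOn s W ∧ ∀ y ∈ W, EmbeddingSpace.resComponent G (Ms 0) (Ms i) univ (s y) = y := by
    intro w
    obtain ⟨j, hij, hj⟩ := hA.exists_mem_range hi w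
    obtain ⟨W, hW, s, hs, hsW⟩ := hA.exists_local_section hi hij hj
    refine ⟨W, hW, fun y => ⟨s y, relComponent_le_fixComponent Ms 0 j (s y).2⟩, ?_, hsW⟩
    rw [IsInducing.subtypeVal.continuousOn_iff]
    have h : ContinuousOn (fun y => (s y : G)) W := continuous_subtype_val.comp_continuousOn hs
    exact h
  have hc : ∀ w : EmbeddingSpace.component G (Ms 0) (Ms i) univ, ∃ g : fixComponent G Ms 0,
      EmbeddingSpace.resComponent G (Ms 0) (Ms i) univ g = w := fun w => by
    obtain ⟨W, hW, s, -, hs⟩ := hloc w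
    exact ⟨s w, hs w (mem_of_mem_nhds hW)⟩
  choose c hc using hc
  have hφU : Continuous fun y : U => φ y := continuousOn_iff_continuous_domRestrict.1 hφ
  obtain ⟨ℓ, hℓ, hℓc⟩ := exists_continuous_lift (Z := U) (fixingSubgroup G (Ms i))
    (fun y => (c (φ y) : G)) (fun y => by
      obtain ⟨W, hW, s, hs, hsW⟩ := hloc (φ y)
      refine ⟨(fun y : U => φ y) ⁻¹' W, hφU.continuousAt hW, fun y => s (φ y),
        continuous_subtype_val.comp_continuousOn (hs.comp hφU.continuousOn fun z hz => hz),
        fun z hz => ?_⟩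
      rw [← EmbeddingSpace.resComponent_eq_iff (N := univ) (K := Ms 0), hc, hsW _ hz])
  have hmem : ∀ y, ℓ y ∈ fixComponent G Ms 0 := fun y => by
    have := Subgroup.mul_mem _ (c (φ y)).2 (fixingSubgroup_le_fixComponent_zero hMs i (hℓc y))
    simpa using this
  let ℓ' : Y → fixComponent G Ms 0 := fun y => if h : y ∈ U then ⟨ℓ ⟨y, h⟩, hmem _⟩ else 1
  have hℓ' : ∀ y : U, ℓ' y = ⟨ℓ y, hmem y⟩ := fun y => dif_pos y.2
  refine ⟨ℓ', continuousOn_iff_continuous_domRestrict.2 ?_, fun y hy => ?_⟩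
  · exact (hℓ.subtype_mk hmem).congr fun y => (hℓ' y).symm
  · rw [hℓ' ⟨y, hy⟩]
    conv_rhs => rw [← hc (φ y)]
    exact ((EmbeddingSpace.resComponent_eq_iff _ _).2 (hℓc ⟨y, hy⟩)).symm

/-- Two maps to `G₀` which have the same restrictions to `M_i` over `B` are homotopic near `B`, and over
`B` the homotopy does not change the restrictions to `M_i`. -/
theorem exists_homotopy_near (hMs : IsExhaustingSequence Ms) (hA : BundleANRAssumption G Ms)
    {i : ℕ} (hi : 0 < i) [ContractibleSpace (fixingSubgroup G (Ms i))]
    {Y : Type u} [TopologicalSpace Y] [TopologicalSpace.MetrizableSpace Y] {B U : Set Y}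
    (hB : IsClosed B) (hU : IsOpen U) (hBU : B ⊆ U) {s s' : Y → fixComponent G Ms 0}
    (hs : ContinuousOn s U) (hs' : ContinuousOn s' U)
    (hss' : ∀ b ∈ B, (s b : G)⁻¹ * s' b ∈ fixingSubgroup G (Ms i)) :
    ∃ (N : Set Y) (Ψ : Y × unitInterval → G), IsOpen N ∧ B ⊆ N ∧ N ⊆ U ∧
      ContinuousOn Ψ (N ×ˢ univ) ∧ (∀ y ∈ N, Ψ (y, 0) = s y) ∧ (∀ y ∈ N, Ψ (y, 1) = s' y) ∧
      (∀ y ∈ N, ∀ t, Ψ (y, t) ∈ fixComponent G Ms 0) ∧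
      ∀ b ∈ B, ∀ t, (s b : G)⁻¹ * Ψ (b, t) ∈ fixingSubgroup G (Ms i) := by
  classical
  let _ := TopologicalSpace.metrizableSpaceMetric Y
  let ρ := EmbeddingSpace.resComponent G (Ms 0) (Ms i) univ
  have hρ : Continuous ρ := EmbeddingSpace.continuous_resComponent _ _ _
  obtain ⟨V, hV, hBV, hVU⟩ := normal_exists_closure_subset hB hU hBU
  let φ : Y × unitInterval → EmbeddingSpace.component G (Ms 0) (Ms i) univ := fun p =>
    if p.2 = 1 then ρ (s' p.1) else ρ (s p.1)
  have hφ1 : ∀ y, φ (y, 1) = ρ (s' y) := fun y => if_pos rfl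
  have hφs : ∀ p ∈ B ×ˢ univ ∪ closure V ×ˢ {(0 : unitInterval)}, φ p = ρ (s p.1) := by
    rintro ⟨y, t⟩ h
    by_cases ht : t = 1
    · subst ht
      rcases h with h | h
      · rw [hφ1]
        exact ((EmbeddingSpace.resComponent_eq_iff _ _).2 (hss' y h.1)).symm
      · exact absurd h.2 (by simp)
    · exact if_neg ht
  have hc0 : IsClosed (B ×ˢ univ ∪ closure V ×ˢ {(0 : unitInterval)}) :=
    (hB.prod isClosed_univ).union (isClosed_closure.prod isClosed_singleton)
  have hc1 : IsClosed (closure V ×ˢ {(1 : unitInterval)}) :=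
    isClosed_closure.prod isClosed_singleton
  have hφ : ContinuousOn φ
      ((B ×ˢ univ ∪ closure V ×ˢ {(0 : unitInterval)}) ∪ closure V ×ˢ {1}) := by
    refine ContinuousOn.union_of_isClosed ?_ ?_ hc0 hc1
    · refine ContinuousOn.congr (f := fun p => ρ (s p.1)) ?_ fun p hp => hφs p hp
      refine hρ.comp_continuousOn (hs.comp continuousOn_fst ?_)
      rintro ⟨y, t⟩ (h | h)
      · exact hBU h.1
      · exact hVU h.1
    · refine ContinuousOn.congr (f := fun p => ρ (s' p.1)) ?_ ?_
      · exact hρ.comp_continuousOn (hs'.comp continuousOn_fst fun p h => hVU h.1)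
      · rintro ⟨y, t⟩ h
        obtain rfl : t = 1 := h.2
        exact hφ1 y
  -- a homotopy of restrictions to `M_i`, stationary on `B`, is lifted to `K`; the ends of `K` are then
  -- corrected by a contraction of `G_{M_i}`
  obtain ⟨N₁, F, hN₁, hDN₁, hF, hFφ⟩ := hA.exists_extension_near hMs hi (hc0.union hc1) hφ
  have hN₁' : IsClosed (Prod.fst '' N₁ᶜ) := isClosedMap_fst_of_compactSpace _ hN₁.isClosed_compl
  let N : Set Y := (Prod.fst '' N₁ᶜ)ᶜ ∩ V
  have hNN₁ : ∀ y ∈ N, ∀ t, (y, t) ∈ N₁ := fun y hy t => by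
    by_contra h
    exact hy.1 ⟨(y, t), h, rfl⟩
  have hNV : ∀ y ∈ N, y ∈ closure V := fun y hy => subset_closure hy.2
  obtain ⟨K, hK, hKF⟩ := hA.exists_lift hMs hi (U := N ×ˢ univ)
    (hF.mono fun p hp => hNN₁ p.1 hp.1 p.2)
  have hKφ : ∀ p ∈ N ×ˢ univ, p ∈ (B ×ˢ univ ∪ closure V ×ˢ {(0 : unitInterval)}) ∪
      closure V ×ˢ {1} → ρ (K p) = φ p := fun p hp h => (hKF p hp).trans (hFφ p h)
  have hδ0 : ∀ y ∈ N, (K (y, 0) : G)⁻¹ * s y ∈ fixingSubgroup G (Ms i) := fun y hy => by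
    have h0 : (y, (0 : unitInterval)) ∈ B ×ˢ univ ∪ closure V ×ˢ {(0 : unitInterval)} :=
      Or.inr ⟨hNV y hy, rfl⟩
    refine (EmbeddingSpace.resComponent_eq_iff (K := Ms 0) (N := univ) _ _).1 ?_
    exact (hKφ (y, 0) ⟨hy, mem_univ _⟩ (Or.inl h0)).trans (hφs _ h0)
  have hδ1 : ∀ y ∈ N, (K (y, 1) : G)⁻¹ * s' y ∈ fixingSubgroup G (Ms i) := fun y hy => by
    refine (EmbeddingSpace.resComponent_eq_iff (K := Ms 0) (N := univ) _ _).1 ?_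
    exact (hKφ (y, 1) ⟨hy, mem_univ _⟩ (Or.inr ⟨hNV y hy, rfl⟩)).trans (hφ1 y)
  obtain ⟨c, hc, hcS, hc0, hc1, -⟩ := exists_contraction (fixingSubgroup G (Ms i))
  have hK' : ContinuousOn (fun p => (K p : G)) (N ×ˢ univ) :=
    continuous_subtype_val.comp_continuousOn hK
  have hKt : ∀ t : unitInterval, ContinuousOn (fun p : Y × unitInterval => (K (p.1, t) : G))
      (N ×ˢ univ) := fun t =>
    hK'.comp (f := fun p : Y × unitInterval => (p.1, t)) (by fun_prop)
      fun p hp => ⟨hp.1, mem_univ _⟩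
  have hsN : ContinuousOn (fun p : Y × unitInterval => (s p.1 : G)) (N ×ˢ univ) :=
    continuous_subtype_val.comp_continuousOn
      (hs.comp continuousOn_fst fun p hp => hVU (hNV _ hp.1))
  have hsN' : ContinuousOn (fun p : Y × unitInterval => (s' p.1 : G)) (N ×ˢ univ) :=
    continuous_subtype_val.comp_continuousOn
      (hs'.comp continuousOn_fst fun p hp => hVU (hNV _ hp.1))
  have hfix := fixingSubgroup_le_fixComponent_zero (G := G) hMs i
  refine ⟨N, fun p => K p * c ((K (p.1, 0) : G)⁻¹ * s p.1, unitInterval.symm p.2) *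
    c ((K (p.1, 1) : G)⁻¹ * s' p.1, p.2), hN₁'.isOpen_compl.inter hV, fun b hb => ⟨?_, hBV hb⟩,
    fun y hy => hVU (hNV y hy), ?_, fun y hy => ?_, fun y hy => ?_, fun y hy t => ?_,
    fun b hb t => ?_⟩
  · rintro ⟨⟨y, t⟩, h, rfl⟩
    exact h (hDN₁ (Or.inl (Or.inl ⟨hb, mem_univ t⟩)))
  · refine (hK'.mul (hc.comp (f := fun p : Y × unitInterval =>
      ((K (p.1, 0) : G)⁻¹ * s p.1, unitInterval.symm p.2)) ?_ ?_)).mul (hc.comp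
      (f := fun p : Y × unitInterval => ((K (p.1, 1) : G)⁻¹ * s' p.1, p.2)) ?_ ?_)
    · exact ((hKt 0).inv.mul hsN).prodMk (by fun_prop)
    · exact fun p hp => ⟨hδ0 _ hp.1, mem_univ _⟩
    · exact ((hKt 1).inv.mul hsN').prodMk (by fun_prop)
    · exact fun p hp => ⟨hδ1 _ hp.1, mem_univ _⟩
  · simp [hc0, hc1 _ (hδ0 y hy)]
  · simp [hc0, hc1 _ (hδ1 y hy)]
  · exact Subgroup.mul_mem _ (Subgroup.mul_mem _ (K _).2 (hfix (hcS _ (hδ0 y hy) _)))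
      (hfix (hcS _ (hδ1 y hy) _))
  · have hbN : b ∈ N := ⟨by
      rintro ⟨⟨y, t⟩, h, rfl⟩
      exact h (hDN₁ (Or.inl (Or.inl ⟨hb, mem_univ t⟩))), hBV hb⟩
    have hbt : (b, t) ∈ B ×ˢ univ ∪ closure V ×ˢ {(0 : unitInterval)} := Or.inl ⟨hb, mem_univ t⟩
    have h1 : (s b : G)⁻¹ * K (b, t) ∈ fixingSubgroup G (Ms i) := by
      refine (EmbeddingSpace.resComponent_eq_iff (K := Ms 0) (N := univ) _ _).1 ?_
      exact ((hKφ (b, t) ⟨hbN, mem_univ _⟩ (Or.inl hbt)).trans (hφs _ hbt)).symm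
    have := Subgroup.mul_mem _ (Subgroup.mul_mem _ h1 (hcS _ (hδ0 b hbN) (unitInterval.symm t)))
      (hcS _ (hδ1 b hbN) t)
    simpa [mul_assoc] using this

theorem isANR_of_contractible (hMs : IsExhaustingSequence Ms) (hA : BundleANRAssumption G Ms)
    (hcontr : ∀ i, 1 ≤ i → ContractibleSpace (fixingSubgroup G (Ms i))) :
    IsANR (fixComponent G Ms 0) := by
  classical
  have hGm := hA.metrizable
  refine ⟨inferInstance, fun Y _ _ B hB f => ?_⟩
  have : ∀ n, ContractibleSpace (fixingSubgroup G (Ms (n + 1))) := fun n => hcontr _ (by omega)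
  let f' : Y → fixComponent G Ms 0 := fun y => if h : y ∈ B then f ⟨y, h⟩ else 1
  have hf'b : ∀ b : B, f' b = f b := fun b => dif_pos b.2
  have hf' : ContinuousOn f' B :=
    continuousOn_iff_continuous_domRestrict.2 (f.continuous.congr fun b => (hf'b b).symm)
  have hs : ∀ n, ∃ (U : Set Y) (s : Y → fixComponent G Ms 0), IsOpen U ∧ B ⊆ U ∧
      ContinuousOn s U ∧ ∀ b ∈ B, (f' b : G)⁻¹ * s b ∈ fixingSubgroup G (Ms (n + 1)) := by
    intro n
    obtain ⟨U, F, hU, hBU, hF, hFf⟩ := hA.exists_extension_near hMs (Nat.succ_pos n) hB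
      ((EmbeddingSpace.continuous_resComponent (Ms 0) (Ms (n + 1)) univ).comp_continuousOn hf')
    obtain ⟨s, hs, hsF⟩ := hA.exists_lift hMs (Nat.succ_pos n) hF
    refine ⟨U, s, hU, hBU, hs, fun b hb => ?_⟩
    refine (EmbeddingSpace.resComponent_eq_iff (K := Ms 0) (N := univ) _ _).1 ?_
    exact ((hsF b (hBU hb)).trans (hFf b hb)).symm
  choose U s hU hBU hs hsf using hs
  have hanti : ∀ n, fixingSubgroup G (Ms (n + 1)) ≤ fixingSubgroup G (Ms n) := fun n =>
    fixingSubgroup_antitone G M (hMs.monotone (Nat.le_succ n))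
  choose N Ψ hN hBN hNU hΨ hΨ0 hΨ1 hΨmem hΨB using fun n =>
    hA.exists_homotopy_near hMs (Nat.succ_pos n) hB ((hU n).inter (hU (n + 1)))
      (subset_inter (hBU n) (hBU (n + 1))) ((hs n).mono inter_subset_left)
      ((hs (n + 1)).mono inter_subset_right) (fun b hb => by
        have := Subgroup.mul_mem _ (Subgroup.inv_mem _ (hsf n b hb)) (hanti _ (hsf (n + 1) b hb))
        simpa [mul_assoc] using this)
  obtain ⟨E, hE, hEb, hEy⟩ := exists_telescope hB (f := fun y => (f' y : G))
    (continuous_subtype_val.comp_continuousOn hf')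
    (H := fun n => fixingSubgroup G (Ms (n + 1)))
    (fun W hW => by
      obtain ⟨n, hn⟩ := hA.weak.exists_fixingSubgroup_subset hMs hW
      exact ⟨n, fun m hm => hn (m + 1) (by omega)⟩)
    hN hBN hΨ (fun n y hy => by rw [hΨ1 n y hy.1, hΨ0 (n + 1) y hy.2])
    (fun n b hb t => by
      have := Subgroup.mul_mem _ (hsf n b hb) (hΨB n b hb t)
      simpa [mul_assoc] using this)
  have hEmem : ∀ y : N 0, E y ∈ fixComponent G Ms 0 := by
    rintro ⟨y, hy⟩
    by_cases hyB : y ∈ B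
    · rw [hEb y hyB]
      exact (f' y).2
    · obtain ⟨n, t, hn, h⟩ := hEy y hy hyB
      rw [h]
      exact hΨmem n y hn t
  refine ⟨N 0, hBN 0, (hN 0).mem_nhdsSet.2 (hBN 0), ⟨fun y => ⟨E y, hEmem y⟩,
    (continuousOn_iff_continuous_domRestrict.1 hE).subtype_mk _⟩, fun b => Subtype.ext ?_⟩
  exact (hEb b b.2).trans (congrArg Subtype.val (hf'b b))

end BundleANRAssumption

end

/-! ### Contractible structure groups: homotopy density -/

section

variable {G : Type u} {M : Type v} [Group G] [TopologicalSpace G] [IsTopologicalGroup G]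
  [TopologicalSpace M] [MulAction G M] {Ms : ℕ → Set M}

namespace BundleANRAssumption

/-- If `G_{M_1}` is connected and the `𝒢^i_{1,j}` are contractible, then `⋃_j G(U_j)₀` is homotopy dense
in `G_{M_1}`. The deformation is a function on `G × [0, 1]`, with junk values off `G_{M_1}`. -/
theorem exists_deformation_fixingSubgroup (hMs : IsExhaustingSequence Ms)
    (hA : BundleANRAssumption G Ms) (hconn : ConnectedSpace (fixingSubgroup G (Ms 1)))
    (hcontr : ∀ i j, 2 ≤ i → i < j → ContractibleSpace (structureGroup G Ms 1 i j)) :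
    ∃ φ : G × unitInterval → G, ContinuousOn φ ((fixingSubgroup G (Ms 1) : Set G) ×ˢ univ) ∧
      (∀ g ∈ fixingSubgroup G (Ms 1), φ (g, 0) = g) ∧
      (∀ g ∈ fixingSubgroup G (Ms 1), ∀ t, φ (g, t) ∈ fixingSubgroup G (Ms 1)) ∧
      ∀ g ∈ fixingSubgroup G (Ms 1), ∀ t, t ≠ 0 → φ (g, t) ∈ compactCore G Ms := by
  classical
  have hGm := hA.metrizable
  have hR : fixComponent G Ms 1 = fixingSubgroup G (Ms 1) :=
    le_antisymm (fixComponent_le_fixingSubgroup Ms 1)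
      (le_identityComponent (relSubgroup_univ _).ge)
  choose σ hσ hσP hσf using fun n => hA.exists_leveled_section hMs (k := 1) (i := n + 2)
    (by omega) fun j hj => hcontr _ j (by omega) hj
  have hanti : ∀ n, fixingSubgroup G (Ms (n + 1 + 2)) ≤ fixingSubgroup G (Ms (n + 2)) := fun n =>
    fixingSubgroup_antitone G M (hMs.monotone (Nat.le_succ (n + 2)))
  let A : ℕ → ℕ → Subgroup G := fun n m => structureGroup G Ms 1 (n + 2) (n + 3 + m)
  have hAmono : ∀ n, Monotone (A n) := fun n m m' h =>
    structureGroup_mono hMs _ _ (Nat.add_le_add_left h _)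
  have hAcontr : ∀ n m, ContractibleSpace (A n m) := fun n m => hcontr _ _ (by omega) (by omega)
  have hδ : ∀ n, LocallyIn (A n) fun z => (σ n z)⁻¹ * σ (n + 1) z := by
    intro n
    have h1 := ((hσP n).inv.mul (relComponent_mono hMs 1) (hσP (n + 1))).shift
      (relComponent_mono hMs 1) (n + 3)
    refine fun z => (h1 z).imp fun m hm => hm.mono fun y hy => ⟨hy, ?_⟩
    have := Subgroup.mul_mem _ (Subgroup.inv_mem _ (hσf n y)) (hanti n (hσf (n + 1) y))
    simpa [mul_assoc] using this
  choose C hCc hCA hC0 hC1 using fun n => exists_leveled_homotopy (hAmono n)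
    ((hσ n).inv.mul (hσ (n + 1))) (hδ n)
  have hCf : ∀ n p, C n p ∈ relComponent G Ms 1 (n + 3 + (hCA n p).choose) ∧
      C n p ∈ fixingSubgroup G (Ms (n + 2)) := fun n p => (hCA n p).choose_spec.self_of_nhds
  let B : Set (fixComponent G Ms 1 × unitInterval) := {p | p.2 = 0}
  have hB : IsClosed B := isClosed_eq continuous_snd continuous_const
  obtain ⟨E, hE, hEb, hEy⟩ := exists_telescope hB (f := fun p => (p.1 : G))
    (continuous_subtype_val.comp continuous_fst).continuousOn
    (H := fun n => fixingSubgroup G (Ms (n + 2)))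
    (fun W hW => by
      obtain ⟨n, hn⟩ := hA.weak.exists_fixingSubgroup_subset hMs hW
      exact ⟨n, fun m hm => hn (m + 2) (by omega)⟩)
    (N := fun _ => univ) (fun _ => isOpen_univ) (fun _ => subset_univ _)
    (Φ := fun n p => σ n p.1.1 * C n (p.1.1, p.2))
    (fun n => (((hσ n).comp (continuous_fst.comp continuous_fst)).mul
      ((hCc n).comp (by fun_prop))).continuousOn)
    (fun n p _ => by
      simp only [hC0, hC1, mul_one, Pi.mul_apply, Pi.inv_apply, mul_inv_cancel_left])
    (fun n p _ t => by
      have := Subgroup.mul_mem _ (hσf n p.1) (hCf n (p.1, t)).2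
      simpa [mul_assoc] using this)
  have hEP : ∀ p ∉ B, ∃ j, E p ∈ relComponent G Ms 1 j := by
    intro p hp
    obtain ⟨n, t, -, h⟩ := hEy p (mem_univ p) hp
    obtain ⟨m, hm⟩ := hσP n p.1
    refine ⟨max m (n + 3 + (hCA n (p.1, t)).choose), ?_⟩
    rw [h]
    exact Subgroup.mul_mem _ (relComponent_mono hMs 1 (le_max_left _ _) hm.self_of_nhds)
      (relComponent_mono hMs 1 (le_max_right _ _) (hCf n (p.1, t)).1)
  rw [continuousOn_univ] at hE
  rw [← hR]
  let φ : G × unitInterval → G := fun p => if h : p.1 ∈ fixComponent G Ms 1 then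
    E (⟨p.1, h⟩, p.2) else 1
  have hφ : ∀ (g : G) (h : g ∈ fixComponent G Ms 1) t, φ (g, t) = E (⟨g, h⟩, t) :=
    fun g h t => dif_pos h
  refine ⟨φ, continuousOn_iff_continuous_domRestrict.2 ?_, fun g hg => ?_, fun g hg t => ?_,
    fun g hg t ht => ?_⟩
  · have : Continuous fun p : ((fixComponent G Ms 1 : Set G) ×ˢ univ : Set (G × unitInterval)) =>
        E (⟨p.1.1, p.2.1⟩, p.1.2) := hE.comp (by fun_prop)
    exact this.congr fun p => (hφ p.1.1 p.2.1 p.1.2).symm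
  · rw [hφ g hg]
    exact hEb (⟨g, hg⟩, 0) rfl
  · rw [hφ g hg]
    by_cases ht : t = 0
    · rw [hEb (⟨g, hg⟩, t) ht]
      exact hg
    · obtain ⟨j, hj⟩ := hEP (⟨g, hg⟩, t) ht
      exact relComponent_le_fixComponent Ms 1 j hj
  · rw [hφ g hg]
    obtain ⟨j, hj⟩ := hEP (⟨g, hg⟩, t) ht
    exact relComponent_le_compactCore hMs 1 j hj

theorem isHomotopyDense_of_contractible [T2Space M] (hMs : IsExhaustingSequence Ms)
    (hA : BundleANRAssumption G Ms) (hconn : ConnectedSpace (fixingSubgroup G (Ms 1)))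
    (hcontr : ∀ i j, 2 ≤ i → i < j → ContractibleSpace (structureGroup G Ms 1 i j)) :
    IsHomotopyDense ((↑) ⁻¹' compactIdentitySet G M : Set (fixComponent G Ms 0)) := by
  classical
  have hGm := hA.metrizable
  let _ := TopologicalSpace.metrizableSpaceMetric (fixComponent G Ms 0)
  obtain ⟨φ, hφ, hφ0, hφf, hφc⟩ := hA.exists_deformation_fixingSubgroup hMs hconn hcontr
  let ρ := EmbeddingSpace.resComponent G (Ms 0) (Ms 1) univ
  have hρ : Continuous ρ := EmbeddingSpace.continuous_resComponent _ _ _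
  obtain ⟨N, F, -, hN, hF, hFR⟩ := exists_section_near (isClosed_univ (X := fixComponent G Ms 0))
    (X := C(unitInterval, G))
    (R := fun h γ => γ 0 = h ∧ (∀ t, (h : G)⁻¹ * γ t ∈ fixingSubgroup G (Ms 1)) ∧
      ∀ t, t ≠ 0 → γ t ∈ compactCore G Ms) (by
    intro h₀ _
    obtain ⟨j, hj, hjr⟩ := hA.exists_mem_range Nat.zero_lt_one (ρ h₀)
    obtain ⟨W, hW, s, hs, hsW⟩ := hA.exists_local_section Nat.zero_lt_one hj hjr
    let O : Set (fixComponent G Ms 0) := interior (ρ ⁻¹' W)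
    have hOW : ∀ h ∈ O, ρ h ∈ W := fun h hh => interior_subset (s := ρ ⁻¹' W) hh
    let s' : fixComponent G Ms 0 → G := fun h => s (ρ h)
    have hs' : ContinuousOn s' O :=
      continuous_subtype_val.comp_continuousOn (hs.comp hρ.continuousOn hOW)
    have hs'c : ∀ h, s' h ∈ compactCore G Ms := fun h =>
      relComponent_le_compactCore hMs 0 j (s (ρ h)).2
    have hs'f : ∀ h ∈ O, (s' h)⁻¹ * h ∈ fixingSubgroup G (Ms 1) := fun h hh =>
      (EmbeddingSpace.resComponent_eq_iff (K := Ms 0) (N := univ) ⟨s' h, _⟩ h).1 (hsW _ (hOW h hh))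
    refine ⟨O, isOpen_interior, mem_interior_iff_mem_nhds.2 (hρ.continuousAt hW),
      fun N F hN hF hFR K hKN hK C hCO hC => ?_⟩
    obtain ⟨l, D, hD, hDN, hl1, hl0⟩ := exists_unitInterval_bump hK hN hKN
    have hsF : ∀ h ∈ O ∩ N, ∀ t, (s' h)⁻¹ * F h t ∈ fixingSubgroup G (Ms 1) := fun h hh t => by
      have := Subgroup.mul_mem _ (hs'f h hh.1) ((hFR h hh.2).2.1 t)
      simpa [mul_assoc] using this
    -- over time `t`, follow the given deformation `F` for a time `t * l`, then the one transported from
    -- `G_{M_1}` for a time `t * (1 - l)`: for `l = 1` this is `F`, and for `l = 0` it does not involve `F`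
    let m : fixComponent G Ms 0 × unitInterval → G := fun p =>
      if p.1 ∈ N then
        s' p.1 * φ ((s' p.1)⁻¹ * F p.1 (p.2 * l p.1), p.2 * unitInterval.symm (l p.1))
      else s' p.1 * φ ((s' p.1)⁻¹ * p.1, p.2)
    have hm1 : ∀ h ∈ N, ∀ t, m (h, t) =
      s' h * φ ((s' h)⁻¹ * F h (t * l h), t * unitInterval.symm (l h)) := fun h hh t => if_pos hh
    have hm2 : ∀ h ∉ D, ∀ t, m (h, t) = s' h * φ ((s' h)⁻¹ * h, t) := fun h hh t => by
      by_cases hN' : h ∈ N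
      · rw [hm1 h hN', hl0 h hh, mul_zero, unitInterval.symm_zero, mul_one, (hFR h hN').1]
      · exact if_neg hN'
    have hm : ContinuousOn m (O ×ˢ univ) := by
      rintro ⟨h, t⟩ ⟨hh, -⟩
      refine ContinuousAt.continuousWithinAt ?_
      by_cases hhN : h ∈ N
      · have hopen : IsOpen ((O ∩ N) ×ˢ (univ : Set unitInterval)) :=
          (isOpen_interior.inter hN).prod isOpen_univ
        refine ContinuousOn.continuousAt ?_ (hopen.mem_nhds ⟨⟨hh, hhN⟩, mem_univ t⟩)
        have hs1 : ContinuousOn (fun p : fixComponent G Ms 0 × unitInterval => s' p.1)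
            ((O ∩ N) ×ˢ univ) := hs'.comp continuousOn_fst fun p hp => hp.1.1
        have hF1 : ContinuousOn (fun p : fixComponent G Ms 0 × unitInterval =>
            F p.1 (p.2 * l p.1)) ((O ∩ N) ×ˢ univ) :=
          ContinuousEval.continuous_eval.comp_continuousOn
            (f := fun p : fixComponent G Ms 0 × unitInterval => (F p.1, p.2 * l p.1))
            ((hF.comp continuousOn_fst fun p hp => hp.1.2).prodMk (by fun_prop))
        refine ContinuousOn.congr (f := fun p => s' p.1 *
          φ ((s' p.1)⁻¹ * F p.1 (p.2 * l p.1), p.2 * unitInterval.symm (l p.1))) ?_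
          fun p hp => hm1 p.1 hp.1.2 p.2
        refine hs1.mul (hφ.comp (f := fun p : fixComponent G Ms 0 × unitInterval =>
          ((s' p.1)⁻¹ * F p.1 (p.2 * l p.1), p.2 * unitInterval.symm (l p.1))) ?_ ?_)
        · exact (hs1.inv.mul hF1).prodMk (by fun_prop)
        · exact fun p hp => ⟨hsF _ hp.1 _, mem_univ _⟩
      · have hhD : h ∉ D := fun hD => hhN (hDN hD)
        have hopen : IsOpen ((O \ D) ×ˢ (univ : Set unitInterval)) :=
          (isOpen_interior.sdiff hD).prod isOpen_univ
        refine ContinuousOn.continuousAt ?_ (hopen.mem_nhds ⟨⟨hh, hhD⟩, mem_univ t⟩)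
        have hs1 : ContinuousOn (fun p : fixComponent G Ms 0 × unitInterval => s' p.1)
            ((O \ D) ×ˢ univ) := hs'.comp continuousOn_fst fun p hp => hp.1.1
        refine ContinuousOn.congr (f := fun p => s' p.1 * φ ((s' p.1)⁻¹ * p.1, p.2)) ?_
          fun p hp => hm2 p.1 hp.1.2 p.2
        refine hs1.mul (hφ.comp (f := fun p : fixComponent G Ms 0 × unitInterval =>
          ((s' p.1)⁻¹ * p.1, p.2)) ?_ ?_)
        · exact (hs1.inv.mul (by fun_prop)).prodMk (by fun_prop)
        · exact fun p hp => ⟨hs'f _ hp.1.1, mem_univ _⟩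
    obtain ⟨F', hF', hF'm⟩ := exists_continuousMap_of_continuousOn hm
    refine ⟨O, F', isOpen_interior, fun h hh => hCO hh.2, hF', fun h hh => ?_, fun h hh => ?_⟩
    · have hf2 : ∀ x, x ∈ fixingSubgroup G (Ms 1) →
          (h : G)⁻¹ * (s' h * x) ∈ fixingSubgroup G (Ms 1) := fun x hx => by
        have := Subgroup.mul_mem _ (Subgroup.inv_mem _ (hs'f h hh)) hx
        simpa [mul_assoc] using this
      by_cases hhN : h ∈ N
      · refine ⟨?_, fun t => ?_, fun t ht => ?_⟩
        · rw [hF'm h hh, hm1 h hhN, zero_mul, zero_mul, hφ0 _ (hsF h ⟨hh, hhN⟩ 0),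
            (hFR h hhN).1, mul_inv_cancel_left]
        · rw [hF'm h hh, hm1 h hhN]
          exact hf2 _ (hφf _ (hsF h ⟨hh, hhN⟩ _) _)
        · rw [hF'm h hh, hm1 h hhN]
          by_cases h0 : t * unitInterval.symm (l h) = 0
          · have hl : l h = 1 := by
              rcases mul_eq_zero.1 h0 with h1 | h1
              · exact absurd h1 ht
              · rw [← unitInterval.symm_symm (l h), h1, unitInterval.symm_zero]
            rw [h0, hφ0 _ (hsF h ⟨hh, hhN⟩ _), hl, mul_one, mul_inv_cancel_left]
            exact (hFR h hhN).2.2 t ht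
          · exact Subgroup.mul_mem _ (hs'c h) (hφc _ (hsF h ⟨hh, hhN⟩ _) _ h0)
      · have hhD : h ∉ D := fun hD => hhN (hDN hD)
        refine ⟨?_, fun t => ?_, fun t ht => ?_⟩
        · rw [hF'm h hh, hm2 h hhD, hφ0 _ (hs'f h hh), mul_inv_cancel_left]
        · rw [hF'm h hh, hm2 h hhD]
          exact hf2 _ (hφf _ (hs'f h hh) _)
        · rw [hF'm h hh, hm2 h hhD]
          exact Subgroup.mul_mem _ (hs'c h) (hφc _ (hs'f h hh) _ ht)
    · ext t
      rw [hF'm h hh.2, hm1 h (hKN hh.1), hl1 h hh.1, unitInterval.symm_one, mul_one, mul_zero,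
        hφ0 _ (hsF h ⟨hh.2, hKN hh.1⟩ _), mul_inv_cancel_left])
  rw [univ_subset_iff] at hN
  subst hN
  have hFR' := fun h => hFR h (mem_univ h)
  have hmem : ∀ p : fixComponent G Ms 0 × unitInterval, F p.1 p.2 ∈ fixComponent G Ms 0 := by
    intro p
    have := Subgroup.mul_mem _ p.1.2
      (fixingSubgroup_le_fixComponent_zero hMs 1 ((hFR' p.1).2.1 p.2))
    simpa using this
  have hFc : Continuous fun p : fixComponent G Ms 0 × unitInterval => F p.1 p.2 :=
    ContinuousEval.continuous_eval.comp (((continuousOn_univ.1 hF).comp continuous_fst).prodMk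
      continuous_snd)
  exact ⟨⟨fun p => ⟨F p.1 p.2, hmem p⟩, hFc.subtype_mk hmem⟩,
    fun x => Subtype.ext (hFR' x).1,
    fun x t ht => compactCore_subset hMs ((hFR' x).2.2 t ht.ne')⟩

end BundleANRAssumption

end

theorem theorem3p1 {G : Type u} {M : Type v} [Group G] [TopologicalSpace G]
    [IsTopologicalGroup G] [TopologicalSpace M] [LocallyCompactSpace M] [SigmaCompactSpace M]
    [T2Space M] [MulAction G M] [ContinuousSMul G M] [FaithfulSMul G M]
    (Ms : ℕ → Set M) (hMs : IsExhaustingSequence Ms) (hA : BundleANRAssumption G Ms) :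
    -- (1)
    ((∀ k i, k < i →
        ContractibleSpace (identityComponent (relSubgroup G (Ms k) (interior (Ms i))))) →
      (∀ k i j, k < i → i < j → ConnectedSpace (structureGroup G Ms k i j)) →
      IsAR (identityComponent (⊤ : Subgroup G)) ∧
        IsHomotopyDense
          ((↑) ⁻¹' compactIdentitySet G M : Set (identityComponent (⊤ : Subgroup G)))) ∧
    -- (2)(i)
    ((∀ i, 1 ≤ i → ContractibleSpace (fixingSubgroup G (Ms i))) →
      IsANR (identityComponent (⊤ : Subgroup G))) ∧
    -- (2)(ii)
    (ConnectedSpace (fixingSubgroup G (Ms 1)) →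
      (∀ i j, 2 ≤ i → i < j → ContractibleSpace (structureGroup G Ms 1 i j)) →
      IsHomotopyDense
        ((↑) ⁻¹' compactIdentitySet G M : Set (identityComponent (⊤ : Subgroup G)))) := by
  rw [← fixComponent_zero hMs]
  exact ⟨hA.isAR_and_isHomotopyDense hMs, hA.isANR_of_contractible hMs,
    hA.isHomotopyDense_of_contractible hMs⟩
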